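/- Let $g:\mathbb{R}_{\ge 0}\to\mathbb{R}$ be a function such that $g(n)$ is a positive integer for every positive integer $n$, and define $p^g(n)$ by $$\sum_{n=0}^{\infty}p^g(n)z^n=\prod_{n=1}^{\infty}(1-z^n)^{-g(n)}.$$ Let $\mathcal{F}$ be the set of functions $f:\mathbb{R}_{\ge 0}\to\mathbb{R}$ that are of bounded variation on every bounded open interval contained in $\mathbb{R}_{>0}$ and satisfy, for every $\varepsilon>0$, $|f(t)|\le C_\varepsilon e^{\varepsilon t}$ for all $t\ge 0$ with some constant $C_\varepsilon>0$. Fix a real number $c>0$ and a positive integer $N$. For $\gamma\in\mathcal{F}$, a positive integer $k$ and $\Re s=c$ put $$w_k^{\gamma}(s)=\int_0^\infty \gamma(x)e^{-skx}\,dx,\qquad \lambda_{\gamma}(s)=\sum_{k=1}^{N}\frac{w_k^{\gamma}(s)}{k},$$ and for $x>0$ put $$\varphi^{\gamma}(x)=\frac{1}{2\pi i}\lim_{T\to\infty}\int_{c-iT}^{c+iT}\frac1s\exp(\lambda_{\gamma}(s))\,e^{xs}\,ds .$$ (+) Let $g_+:\mathbb{R}_{\ge0}\to\mathbb{R}_{\ge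 0}$ belong to $\mathcal{F}$ and satisfy $g(\lceil x\rceil)\le g_+(x)$ for all $x\ge 0$. If there are $\alpha,D>0$ such that $|w_k^{g_+}(s)|\le D|ks|^{-\alpha}$ for all $1\le k\le N$ and all $s$ with $\Re s=c$, then the limit $\varphi^{g_+}(x)$ exists and is a real number for every $x>0$, and $$\sum_{n=0}^{N}p^g(n)\le \varphi^{g_+}(N).$$ (−) Let $g_-:\mathbb{R}_{\ge0}\to\mathbb{R}_{\ge 0}$ belong to $\mathcal{F}$ and satisfy $g_-(x)\le g(\lfloor x\rfloor)$ for all $x\ge 0$. If there are $\alpha,D>0$ such that $|w_k^{g_-}(s)|\le D|ks|^{-\alpha}$ for all $1\le k\le N$ and all $s$ with $\Re s=c$, then the limit $\varphi^{g_-}(x)$ exists and is a real number for every $x>0$, and $$e^{-g(0)}N^{-g(0)}\varphi^{g_-}(N)\le \sum_{n=0}^{N}p^g(n).$$ -/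

import Mathlib

open Filter Topology

/-- The class `𝓕`. A function on `[0, ∞)` is represented by a function on `ℝ` of which only the
values at `x ≥ 0` matter: bounded variation on every bounded open interval contained in `(0, ∞)`,
and `f t = O(e^{ε t})` on `t ≥ 0` for every `ε > 0`. -/
def ClassF : Set (ℝ → ℝ) :=
  {f | (∀ a b : ℝ, 0 ≤ a → a < b → BoundedVariationOn f (Set.Ioo a b)) ∧
    ∀ ε : ℝ, 0 < ε → ∃ C : ℝ, 0 < C ∧ ∀ t : ℝ, 0 ≤ t → |f t| ≤ C * Real.exp (ε * t)}

/-- The factor `(1 - z^n)^{-g(n)}` at the index `n + 1`. It is used only for `g` whose value at each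
positive integer is a positive integer, so that `⌊g (n + 1)⌋₊ = g (n + 1)`. -/
noncomputable def genFactor (g : ℝ → ℝ) (n : ℕ) : PowerSeries ℝ :=
  ((1 - PowerSeries.X ^ (n + 1) : PowerSeries ℝ)⁻¹) ^ ⌊g ((n + 1 : ℕ) : ℝ)⌋₊

open scoped PowerSeries.WithPiTopology in
/-- The product that defines the generating function converges. -/
theorem multipliable_genFactor (g : ℝ → ℝ) : Multipliable (genFactor g) := by
  have hd : ∀ n, (PowerSeries.X : PowerSeries ℝ) ^ (n + 1) ∣ genFactor g n - 1 := by
    intro n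
    have h1 : (PowerSeries.X : PowerSeries ℝ) ^ (n + 1) ∣
        ((1 - PowerSeries.X ^ (n + 1) : PowerSeries ℝ)⁻¹) - 1 := by
      refine ⟨(1 - PowerSeries.X ^ (n + 1) : PowerSeries ℝ)⁻¹, ?_⟩
      have h := PowerSeries.mul_inv_cancel (1 - PowerSeries.X ^ (n + 1) : PowerSeries ℝ) (by simp)
      linear_combination h
    have h2 := sub_dvd_pow_sub_pow ((1 - PowerSeries.X ^ (n + 1) : PowerSeries ℝ)⁻¹) 1
      ⌊g ((n + 1 : ℕ) : ℝ)⌋₊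
    rw [one_pow] at h2
    exact h1.trans h2
  have h := PowerSeries.WithPiTopology.multipliable_one_add_of_tendsto_order_atTop_nhds_top
    (R := ℝ) (f := fun n => genFactor g n - 1) ?_
  · simpa using h
  · rw [ENat.tendsto_nhds_top_iff_natCast_lt]
    intro n
    filter_upwards [eventually_ge_atTop n] with m hm
    refine lt_of_lt_of_le ?_ (PowerSeries.nat_le_order _ _ (PowerSeries.X_pow_dvd_iff.mp (hd m)))
    exact_mod_cast Nat.lt_succ_of_le hm

open scoped PowerSeries.WithPiTopology in
/-- The generating function `∏_{n ≥ 1} (1 - z^n)^{-g(n)}`, an infinite product of formal power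
series in the topology of coefficientwise convergence. -/
noncomputable def genFun (g : ℝ → ℝ) : PowerSeries ℝ := ∏' n : ℕ, genFactor g n

/-- The generalized partition function `p^g(n)`, the coefficient of `z^n`. -/
noncomputable def genPartition (g : ℝ → ℝ) (n : ℕ) : ℝ := PowerSeries.coeff n (genFun g)

/-- `w_k(s) = ∫_0^∞ γ(x) e^{-skx} dx`. -/
noncomputable def laplaceW (γ : ℝ → ℝ) (k : ℕ) (s : ℂ) : ℂ :=
  ∫ x in Set.Ioi (0 : ℝ), (γ x : ℂ) * Complex.exp (-(s * k * x))

/-- `λ(s) = ∑_{k=1}^N w_k(s) / k`. -/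
noncomputable def lambdaSum (γ : ℝ → ℝ) (N : ℕ) (s : ℂ) : ℂ :=
  ∑ k ∈ Finset.Icc 1 N, laplaceW γ k s / k

/-- `(1 / 2πi) ∫_{c-iT}^{c+iT} F(s) ds`, with the segment parametrized by `s = c + i t`,
`-T ≤ t ≤ T`. -/
noncomputable def verticalIntegral (c T : ℝ) (F : ℂ → ℂ) : ℂ :=
  1 / (2 * Real.pi * Complex.I) *
    ∫ t in (-T)..T, F ((c : ℂ) + t * Complex.I) * Complex.I

/-- `(1 / 2πi) lim_{T → ∞} ∫_{c-iT}^{c+iT} (1/s) exp(λ(s)) e^{xs} ds` converges to the real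
number `y`. -/
def BromwichConvergesTo (γ : ℝ → ℝ) (N : ℕ) (c x y : ℝ) : Prop :=
  Tendsto
    (fun T : ℝ => verticalIntegral c T
      (fun s => 1 / s * Complex.exp (lambdaSum γ N s) * Complex.exp (x * s)))
    atTop (𝓝 (y : ℂ))

/-- There are `α, D > 0` with `|w_k(s)| ≤ D |ks|^{-α}` for `1 ≤ k ≤ N` and `Re s = c`. -/
def TransformDecay (γ : ℝ → ℝ) (N : ℕ) (c : ℝ) : Prop :=
  ∃ α D : ℝ, 0 < α ∧ 0 < D ∧ ∀ k : ℕ, 1 ≤ k → k ≤ N → ∀ s : ℂ, s.re = c →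
    ‖laplaceW γ k s‖ ≤ D * ‖(k : ℂ) * s‖ ^ (-α)

/-! The logarithm of the generating function is `∑ g(n) z^{kn} / k`, and terms with `k > N` or `n >
N` do not affect coefficients up to `N`. Let `P` be the truncated logarithm. Then `∑_{n ≤ N} p^g(n)`
is the coefficient of `z^N` in `exp(P) / (1 - z)`, that is, the mass of `[0, N]` under the
convolution exponential of the discrete measure with mass `g(n) / k` at `kn`
(`hasSum_sum_genPartition`).

The analytic side is the same object for a density. `lambdaSum γ N` is the Laplace transform of
`lambdaKernel γ N`, which spreads `γ(u) du / k` along `ku`. The mass `convExp` that its convolution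
exponential gives to `[0, x]` has transform `exp(λ(s)) / s`, so the Bromwich integral recovers
`convExp` (`bromwichConvergesTo_convExp`). As `exp(λ(s)) / s` need not be absolutely integrable on
the line, the jump part `1 / s` is inverted by hand; the rest is `O(|s|^{-1-α})` and falls under
Fourier inversion.

The two masses are compared power by power. Replacing the mass at `n` by a density at least `g(⌈x⌉)`
on `(n - 1, n)` adds mass and moves it left, which increases the mass of `[0, N]`; a density at most
`g(⌊x⌋)` on `(n, n + 1)` does the opposite (`coeff_logSeries_pow_le_convIter`,
`convIter_le_coeff_logSeries_pow`). In the second case the discrete measure also has atoms at `0`,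
of total mass `g(0) (1 + 1/2 + ... + 1/N)`. They multiply the sum by the exponential of that number,
at most `e^{g(0)} N^{g(0)}`. -/

open MeasureTheory

/-! ### Exponentials of power series -/

/-- The exponential `∑ P ^ m / m!` of a real power series, with arbitrary constant coefficient. -/
noncomputable def seriesExp (P : PowerSeries ℝ) : PowerSeries ℝ :=
  PowerSeries.mk fun j => ∑' m : ℕ, PowerSeries.coeff j (P ^ m) / m.factorial

/-- The sum of absolute values of the coefficients up to `J` is submultiplicative. A bound of this
kind is needed because a nonzero constant coefficient keeps `P ^ m` from tending to zero
`X`-adically. -/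
theorem abs_coeff_pow_le (P : PowerSeries ℝ) (J m : ℕ) :
    ∀ j ≤ J, |PowerSeries.coeff j (P ^ m)| ≤
      (∑ i ∈ Finset.range (J + 1), |PowerSeries.coeff i P|) ^ m := by
  induction m with
  | zero =>
    intro j _
    rw [pow_zero, PowerSeries.coeff_one, pow_zero]
    split_ifs <;> simp
  | succ m ih =>
    intro j hj
    set K := ∑ i ∈ Finset.range (J + 1), |PowerSeries.coeff i P| with hK
    have hK0 : 0 ≤ K := Finset.sum_nonneg fun _ _ => abs_nonneg _
    rw [pow_succ', PowerSeries.coeff_mul, Finset.Nat.sum_antidiagonal_eq_sum_range_succ_mk]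
    calc |∑ i ∈ Finset.range j.succ, PowerSeries.coeff i P * PowerSeries.coeff (j - i) (P ^ m)|
        ≤ ∑ i ∈ Finset.range j.succ, |PowerSeries.coeff i P| * K ^ m := by
          refine (Finset.abs_sum_le_sum_abs _ _).trans (Finset.sum_le_sum fun i _ => ?_)
          rw [abs_mul]
          exact mul_le_mul_of_nonneg_left (ih _ (by omega)) (abs_nonneg _)
      _ = (∑ i ∈ Finset.range j.succ, |PowerSeries.coeff i P|) * K ^ m := by
          rw [Finset.sum_mul]
      _ ≤ K * K ^ m := by
          refine mul_le_mul_of_nonneg_right ?_ (pow_nonneg hK0 _)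
          refine Finset.sum_le_sum_of_subset_of_nonneg ?_ fun _ _ _ => abs_nonneg _
          exact Finset.range_subset_range.2 (by omega)
      _ = K ^ (m + 1) := (pow_succ' _ _).symm

theorem hasSum_seriesExp (P : PowerSeries ℝ) (j : ℕ) :
    HasSum (fun m : ℕ => PowerSeries.coeff j (P ^ m) / m.factorial)
      (PowerSeries.coeff j (seriesExp P)) := by
  rw [seriesExp, PowerSeries.coeff_mk]
  refine Summable.hasSum ?_
  refine Summable.of_norm_bounded
    (Real.summable_pow_div_factorial (∑ i ∈ Finset.range (j + 1), |PowerSeries.coeff i P|)) ?_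
  intro m
  rw [norm_div, Real.norm_eq_abs, RCLike.norm_natCast]
  gcongr
  exact abs_coeff_pow_le P j m j le_rfl

theorem hasSum_coeff_pow_mul (P A : PowerSeries ℝ) (j : ℕ) :
    HasSum (fun m : ℕ => PowerSeries.coeff j (P ^ m * A) / m.factorial)
      (PowerSeries.coeff j (seriesExp P * A)) := by
  simp_rw [PowerSeries.coeff_mul, Finset.sum_div]
  refine hasSum_sum fun x _ => ?_
  simpa only [div_mul_eq_mul_div] using
    (hasSum_seriesExp P x.1).mul_right (PowerSeries.coeff x.2 A)

theorem coeff_zero_seriesExp (P : PowerSeries ℝ) :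
    PowerSeries.coeff 0 (seriesExp P) = Real.exp (PowerSeries.coeff 0 P) := by
  have h1 := hasSum_seriesExp P 0
  have h2 := NormedSpace.expSeries_div_hasSum_exp (PowerSeries.coeff 0 P)
  rw [← Real.exp_eq_exp_ℝ] at h2
  simp only [PowerSeries.coeff_zero_eq_constantCoeff, map_pow] at h1 h2 ⊢
  exact h1.unique h2

theorem derivative_seriesExp (P : PowerSeries ℝ) :
    PowerSeries.derivative ℝ (seriesExp P) = seriesExp P * PowerSeries.derivative ℝ P := by
  ext j
  rw [PowerSeries.coeff_derivative]
  have h1 := (hasSum_seriesExp P (j + 1)).mul_right ((j : ℝ) + 1)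
  -- The term `m = 0` drops out, since `P ^ 0 = 1` has no coefficient in positive degree.
  rw [← hasSum_nat_add_iff' 1] at h1
  have h2 := hasSum_coeff_pow_mul P (PowerSeries.derivative ℝ P) j
  simp only [Finset.sum_range_one, pow_zero, PowerSeries.coeff_one, Nat.add_eq_zero_iff,
    one_ne_zero, and_false, if_false, zero_div, zero_mul, sub_zero] at h1
  have h3 (m : ℕ) : PowerSeries.coeff (j + 1) (P ^ (m + 1)) / (m + 1).factorial * ((j : ℝ) + 1) =
      PowerSeries.coeff j (P ^ m * PowerSeries.derivative ℝ P) / m.factorial := by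
    have h4 : PowerSeries.coeff j (PowerSeries.derivative ℝ (P ^ (m + 1))) =
        (m + 1 : ℝ) * PowerSeries.coeff j (P ^ m * PowerSeries.derivative ℝ P) := by
      rw [PowerSeries.derivative_pow, Nat.add_sub_cancel, mul_assoc,
        ← map_natCast (PowerSeries.C), PowerSeries.coeff_C_mul]
      push_cast
      ring
    rw [PowerSeries.coeff_derivative] at h4
    rw [div_mul_eq_mul_div, h4, Nat.factorial_succ]
    have : (m.factorial : ℝ) ≠ 0 := by positivity
    push_cast
    field_simp
  simp only [h3] at h1
  exact h1.unique h2

/-- Comparing coefficients in `A' = A Q` gives `(j + 1) a_{j+1} = ∑ a_i q_{j-i}`, a linear recursion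
determined by `a_0`; up to degree `N` it sees only the coefficients of `Q` below `N`. -/
theorem coeff_eq_of_derivative_eq_mul {A B Q R : PowerSeries ℝ} {r : ℝ} {N : ℕ}
    (hA : PowerSeries.derivative ℝ A = A * Q) (hB : PowerSeries.derivative ℝ B = B * R)
    (h0 : PowerSeries.coeff 0 A = r * PowerSeries.coeff 0 B)
    (hQR : ∀ i < N, PowerSeries.coeff i Q = PowerSeries.coeff i R) :
    ∀ j ≤ N, PowerSeries.coeff j A = r * PowerSeries.coeff j B := by
  intro j
  induction j using Nat.strong_induction_on with
  | _ j ih =>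
    intro hj
    cases j with
    | zero => exact h0
    | succ j =>
      have h1 := congrArg (PowerSeries.coeff j) hA
      have h2 := congrArg (PowerSeries.coeff j) hB
      rw [PowerSeries.coeff_derivative, PowerSeries.coeff_mul] at h1 h2
      have h3 : ∑ p ∈ Finset.HasAntidiagonal.antidiagonal j, PowerSeries.coeff p.1 A * PowerSeries.coeff p.2 Q =
          r * ∑ p ∈ Finset.HasAntidiagonal.antidiagonal j, PowerSeries.coeff p.1 B * PowerSeries.coeff p.2 R := by
        rw [Finset.mul_sum]
        refine Finset.sum_congr rfl fun p hp => ?_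
        rw [Finset.HasAntidiagonal.mem_antidiagonal] at hp
        rw [ih p.1 (by omega) (by omega), hQR p.2 (by omega), mul_assoc]
      have h4 : (j : ℝ) + 1 ≠ 0 := by positivity
      refine mul_right_cancel₀ h4 ?_
      rw [h1, h3, ← h2, mul_assoc]

theorem sum_Icc_one_eq_sum_range {M : Type*} [AddCommMonoid M] (f : ℕ → M) (N : ℕ) :
    ∑ k ∈ Finset.Icc 1 N, f k = ∑ k ∈ Finset.range N, f (k + 1) := by
  rw [Finset.range_eq_Ico, Finset.sum_Ico_add']
  rfl

/-! ### The generating function as an exponential -/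

/-- The truncated logarithm `∑_{k, n ≤ N} g(n) z^{kn} / k` of the generating function, with `n`
running over the finite set `I`. -/
noncomputable def logSeries (g : ℝ → ℝ) (N : ℕ) (I : Finset ℕ) : PowerSeries ℝ :=
  ∑ k ∈ Finset.Icc 1 N, ∑ n ∈ I, PowerSeries.C (g n / k) * PowerSeries.X ^ (k * n)

theorem X_pow_dvd_genFactor_sub_one (g : ℝ → ℝ) (n : ℕ) :
    (PowerSeries.X : PowerSeries ℝ) ^ (n + 1) ∣ genFactor g n - 1 := by
  have h1 : (PowerSeries.X : PowerSeries ℝ) ^ (n + 1) ∣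
      ((1 - PowerSeries.X ^ (n + 1) : PowerSeries ℝ)⁻¹) - 1 := by
    refine ⟨(1 - PowerSeries.X ^ (n + 1) : PowerSeries ℝ)⁻¹, ?_⟩
    have h := PowerSeries.mul_inv_cancel (1 - PowerSeries.X ^ (n + 1) : PowerSeries ℝ) (by simp)
    linear_combination h
  have h2 := sub_dvd_pow_sub_pow ((1 - PowerSeries.X ^ (n + 1) : PowerSeries ℝ)⁻¹) 1
    ⌊g ((n + 1 : ℕ) : ℝ)⌋₊
  rw [one_pow] at h2
  exact h1.trans h2

/-- Each extra factor is `1` modulo `X ^ (N + 1)`. -/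
theorem coeff_prod_genFactor_stable (g : ℝ → ℝ) {j N M : ℕ} (hj : j ≤ N) (hM : N ≤ M) :
    PowerSeries.coeff j (∏ n ∈ Finset.range M, genFactor g n) =
      PowerSeries.coeff j (∏ n ∈ Finset.range N, genFactor g n) := by
  induction M, hM using Nat.le_induction with
  | base => rfl
  | succ M hM ih =>
    rw [← ih, Finset.prod_range_succ, ← sub_eq_zero, ← map_sub]
    obtain ⟨q, hq⟩ := X_pow_dvd_genFactor_sub_one g M
    refine (PowerSeries.X_pow_dvd_iff (n := M + 1)).1
      ⟨(∏ n ∈ Finset.range M, genFactor g n) * q, ?_⟩ j (by omega)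
    linear_combination (∏ n ∈ Finset.range M, genFactor g n) * hq

open scoped PowerSeries.WithPiTopology in
theorem genPartition_eq_coeff_prod (g : ℝ → ℝ) {j N : ℕ} (hj : j ≤ N) :
    genPartition g j = PowerSeries.coeff j (∏ n ∈ Finset.range N, genFactor g n) := by
  have h1 := (multipliable_genFactor g).hasProd.tendsto_prod_nat
  have h2 := ((PowerSeries.WithPiTopology.continuous_coeff ℝ j).tendsto _).comp h1
  refine tendsto_nhds_unique h2 (tendsto_const_nhds.congr' ?_)
  filter_upwards [eventually_ge_atTop N] with M hM
  exact (coeff_prod_genFactor_stable g hj hM).symm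

theorem derivative_genFactor (g : ℝ → ℝ) (n : ℕ) :
    PowerSeries.derivative ℝ (genFactor g n) = genFactor g n *
      (PowerSeries.C ((⌊g ((n + 1 : ℕ) : ℝ)⌋₊ : ℝ) * (n + 1)) * PowerSeries.X ^ n *
        (1 - PowerSeries.X ^ (n + 1) : PowerSeries ℝ)⁻¹) := by
  rw [genFactor]
  set m := ⌊g ((n + 1 : ℕ) : ℝ)⌋₊
  have h1 : PowerSeries.derivative ℝ (1 - PowerSeries.X ^ (n + 1) : PowerSeries ℝ) =
      -(PowerSeries.C ((n : ℝ) + 1) * PowerSeries.X ^ n) := by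
    rw [map_sub, PowerSeries.derivative_pow]
    simp
  rw [PowerSeries.derivative_pow, PowerSeries.derivative_inv', h1]
  rcases m with _ | m
  · simp
  · simp only [Nat.add_sub_cancel, map_mul, map_natCast]
    ring

theorem derivative_prod_genFactor (g : ℝ → ℝ) (N : ℕ) :
    PowerSeries.derivative ℝ (∏ n ∈ Finset.range N, genFactor g n) =
      (∏ n ∈ Finset.range N, genFactor g n) * ∑ n ∈ Finset.range N,
        (PowerSeries.C ((⌊g ((n + 1 : ℕ) : ℝ)⌋₊ : ℝ) * (n + 1)) * PowerSeries.X ^ n *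
          (1 - PowerSeries.X ^ (n + 1) : PowerSeries ℝ)⁻¹) := by
  induction N with
  | zero => simp
  | succ N ih =>
    rw [Finset.prod_range_succ, Finset.sum_range_succ, Derivation.leibniz, ih,
      derivative_genFactor, smul_eq_mul, smul_eq_mul]
    ring

theorem coeff_zero_prod_genFactor (g : ℝ → ℝ) (N : ℕ) :
    PowerSeries.coeff 0 (∏ n ∈ Finset.range N, genFactor g n) = 1 := by
  rw [coeff_prod_genFactor_stable g le_rfl (Nat.zero_le N)]
  simp

/-- At `n = 0` the truncated exponent `k * n - 1` is harmless because the factor `g n * n` vanishes.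
-/
theorem derivative_logSeries (g : ℝ → ℝ) (N : ℕ) (I : Finset ℕ) :
    PowerSeries.derivative ℝ (logSeries g N I) =
      ∑ n ∈ I, PowerSeries.C (g n * n) *
        ∑ k ∈ Finset.Icc 1 N, PowerSeries.X ^ (k * n - 1) := by
  simp only [logSeries, map_sum]
  rw [Finset.sum_comm]
  refine Finset.sum_congr rfl fun n _ => ?_
  rw [Finset.mul_sum]
  refine Finset.sum_congr rfl fun k hk => ?_
  have hk0 : (k : ℝ) ≠ 0 := by
    have := (Finset.mem_Icc.1 hk).1
    positivity
  rw [Derivation.leibniz, PowerSeries.derivative_C, smul_zero, add_zero,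
    PowerSeries.derivative_pow, PowerSeries.derivative_X, mul_one, smul_eq_mul, ← mul_assoc,
    ← map_natCast (PowerSeries.C (R := ℝ)), ← map_mul]
  congr 2
  push_cast
  field_simp

/-- The tail of the geometric series starts at degree `n + (n + 1) N`, which is at least `N`. -/
theorem coeff_geom_sum_eq_inv {N n i : ℕ} (hi : i < N) :
    PowerSeries.coeff i (∑ k ∈ Finset.Icc 1 N, (PowerSeries.X : PowerSeries ℝ) ^ (k * (n + 1) - 1)) =
      PowerSeries.coeff i
        (PowerSeries.X ^ n * (1 - PowerSeries.X ^ (n + 1) : PowerSeries ℝ)⁻¹) := by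
  have h := PowerSeries.mul_inv_cancel (1 - PowerSeries.X ^ (n + 1) : PowerSeries ℝ) (by simp)
  have h1 : ∑ k ∈ Finset.Icc 1 N, (PowerSeries.X : PowerSeries ℝ) ^ (k * (n + 1) - 1) =
      PowerSeries.X ^ n * ∑ k ∈ Finset.range N, (PowerSeries.X ^ (n + 1)) ^ k := by
    rw [Finset.mul_sum, sum_Icc_one_eq_sum_range]
    refine Finset.sum_congr rfl fun k _ => ?_
    rw [← pow_mul, ← pow_add]
    congr 1
    rw [add_mul, one_mul, mul_comm (n + 1) k]
    omega
  have h2 := mul_neg_geom_sum ((PowerSeries.X : PowerSeries ℝ) ^ (n + 1)) N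
  rw [h1, ← sub_eq_zero, ← map_sub]
  refine (PowerSeries.X_pow_dvd_iff (n := N)).1
    ⟨- PowerSeries.X ^ (n * N + n) * (1 - PowerSeries.X ^ (n + 1) : PowerSeries ℝ)⁻¹, ?_⟩ i hi
  have h3 : (PowerSeries.X : PowerSeries ℝ) ^ N * PowerSeries.X ^ (n * N + n) =
      PowerSeries.X ^ n * (PowerSeries.X ^ (n + 1)) ^ N := by
    ring
  linear_combination
    (PowerSeries.X ^ n * (1 - PowerSeries.X ^ (n + 1) : PowerSeries ℝ)⁻¹) * h2 -
    (PowerSeries.X ^ n * ∑ k ∈ Finset.range N, (PowerSeries.X ^ (n + 1)) ^ k) * h -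
    (1 - PowerSeries.X ^ (n + 1) : PowerSeries ℝ)⁻¹ * h3

/-- Both sides have the same logarithmic derivative below degree `N`. An index `0` in `I`
contributes only a constant to the logarithm: differentiation kills it, and it survives as the
exponential factor. -/
theorem coeff_seriesExp_logSeries {g : ℝ → ℝ} {N : ℕ}
    (hg : ∀ n : ℕ, 0 < n → ∃ m : ℕ, 0 < m ∧ g (n : ℝ) = (m : ℝ)) {I : Finset ℕ}
    (hI : I.erase 0 = Finset.Icc 1 N) {j : ℕ} (hj : j ≤ N) :
    PowerSeries.coeff j (seriesExp (logSeries g N I)) =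
      Real.exp (PowerSeries.coeff 0 (logSeries g N I)) * genPartition g j := by
  rw [genPartition_eq_coeff_prod g hj]
  refine coeff_eq_of_derivative_eq_mul (derivative_seriesExp _) (derivative_prod_genFactor g N)
    ?_ ?_ j hj
  · rw [coeff_zero_seriesExp, coeff_zero_prod_genFactor, mul_one]
  · intro i hi
    rw [derivative_logSeries, ← Finset.sum_erase I (a := 0) (by simp), hI, map_sum, map_sum,
      sum_Icc_one_eq_sum_range]
    refine Finset.sum_congr rfl fun n _ => ?_
    rw [mul_assoc, PowerSeries.coeff_C_mul, PowerSeries.coeff_C_mul,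
      coeff_geom_sum_eq_inv hi]
    obtain ⟨m, -, hm⟩ := hg (n + 1) n.succ_pos
    rw [hm, Nat.floor_natCast]
    push_cast
    rfl

/-! ### Inversion of the Laplace transform -/

/-- On the line `Re s = c` the Laplace transform of `F` is the Fourier transform of `F y * e^{-cy}`
at frequency `t / 2π`, so Fourier inversion at a continuity point applies. The majorant `b` makes
the integral absolutely convergent, hence the limit of its truncations. -/
theorem tendsto_verticalIntegral_laplace {F : ℝ → ℂ} {c x : ℝ} {b : ℝ → ℝ}
    (hF : Integrable fun y : ℝ => F y * Complex.exp (-((c : ℂ) * y)))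
    (hb : Integrable b)
    (hle : ∀ t : ℝ, ‖∫ y : ℝ, F y * Complex.exp (-(((c : ℂ) + t * Complex.I) * y))‖ ≤ b t)
    (hx : ContinuousAt F x) :
    Integrable (fun t : ℝ => (∫ y : ℝ, F y * Complex.exp (-(((c : ℂ) + t * Complex.I) * y))) *
      Complex.exp (x * ((c : ℂ) + t * Complex.I))) ∧
    Tendsto (fun T : ℝ => verticalIntegral c T
      (fun s => (∫ y : ℝ, F y * Complex.exp (-(s * y))) * Complex.exp (x * s)))
      atTop (𝓝 (F x)) := by
  set f : ℝ → ℂ := fun y => F y * Complex.exp (-((c : ℂ) * y)) with hf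
  set L : ℂ → ℂ := fun s => ∫ y : ℝ, F y * Complex.exp (-(s * y)) with hL
  have hpi : (2 * Real.pi : ℝ) ≠ 0 := by positivity
  have hfour (w : ℝ) :
      FourierTransform.fourier f w = L ((c : ℂ) + (2 * Real.pi * w : ℝ) * Complex.I) := by
    rw [Real.fourier_real_eq_integral_exp_smul]
    refine integral_congr_ae (ae_of_all _ fun y => ?_)
    simp only [hf, smul_eq_mul]
    rw [mul_left_comm, ← Complex.exp_add]
    congr 2
    push_cast
    ring
  have hcont : Continuous (FourierTransform.fourier f) :=
    VectorFourier.fourierIntegral_continuous Real.continuous_fourierChar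
      (by exact continuous_inner) hF
  have hint : Integrable (FourierTransform.fourier f) := by
    refine Integrable.mono' (hb.comp_mul_left' hpi) hcont.aestronglyMeasurable
      (ae_of_all _ fun w => ?_)
    rw [hfour]
    exact hle _
  have hcx : ContinuousAt f x := hx.mul (by fun_prop)
  have hinv := hF.fourierInv_fourier_eq hint hcx
  rw [Real.fourierInv_eq'] at hinv
  set G : ℝ → ℂ := fun t =>
    L ((c : ℂ) + t * Complex.I) * Complex.exp (x * ((c : ℂ) + t * Complex.I)) with hG
  have hGw (w : ℝ) : G (2 * Real.pi * w) = Complex.exp (x * c) *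
      (Complex.exp (((2 * Real.pi * inner ℝ w x : ℝ) : ℂ) * Complex.I) •
        FourierTransform.fourier f w) := by
    rw [hfour, hG]
    simp only [smul_eq_mul]
    rw [← mul_assoc, ← Complex.exp_add, mul_comm]
    congr 2
    simp only [RCLike.inner_apply, conj_trivial]
    push_cast
    ring
  have hGint : Integrable G := by
    rw [← integrable_comp_mul_left_iff G hpi]
    simp_rw [hGw]
    refine Integrable.const_mul ?_ _
    refine hint.bdd_mul (c := 1) ?_ (ae_of_all _ fun w => ?_)
    · exact Continuous.aestronglyMeasurable (by fun_prop)
    · rw [Complex.norm_exp_ofReal_mul_I]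
  have hGval : ∫ t, G t = 2 * Real.pi * F x := by
    have h1 := Measure.integral_comp_mul_left G (2 * Real.pi)
    simp_rw [hGw] at h1
    rw [integral_const_mul, hinv, abs_of_pos (by positivity)] at h1
    have h2 : Complex.exp (x * c) * f x = F x := by
      rw [hf]
      simp only
      rw [mul_left_comm, ← Complex.exp_add, mul_comm (c : ℂ), add_neg_cancel, Complex.exp_zero,
        mul_one]
    rw [h2, Complex.real_smul] at h1
    rw [h1]
    have : (Real.pi : ℂ) ≠ 0 := by exact_mod_cast Real.pi_ne_zero
    push_cast
    field_simp
  have hlim := (intervalIntegral_tendsto_integral (hGint.mul_const Complex.I)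
    tendsto_neg_atTop_atBot tendsto_id).const_mul (1 / (2 * Real.pi * Complex.I))
  rw [integral_mul_const, hGval] at hlim
  have hval : 1 / (2 * Real.pi * Complex.I) * (2 * Real.pi * F x * Complex.I) = F x := by
    have : (Real.pi : ℂ) ≠ 0 := by exact_mod_cast Real.pi_ne_zero
    field_simp
  rw [hval] at hlim
  exact ⟨hGint, hlim⟩

/-! ### Majorants and explicit inversions on the vertical line -/

theorem one_add_sq_rpow_bound {c r : ℝ} (hc : 0 < c) (hr : 0 ≤ r) (t : ℝ) :
    ‖(c : ℂ) + t * Complex.I‖ ^ (-r) ≤ (min 1 c) ^ (-r) * (1 + ‖t‖ ^ 2) ^ (-r / 2) := by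
  have hm : 0 < min 1 c := lt_min one_pos hc
  have h1 : min 1 c * Real.sqrt (1 + ‖t‖ ^ 2) ≤ ‖(c : ℂ) + t * Complex.I‖ := by
    rw [Complex.norm_add_mul_I]
    refine Real.le_sqrt_of_sq_le ?_
    rw [mul_pow, Real.sq_sqrt (by positivity), Real.norm_eq_abs, sq_abs]
    have h2 : min 1 c ^ 2 ≤ 1 := pow_le_one₀ hm.le (min_le_left _ _)
    have h3 : min 1 c ^ 2 ≤ c ^ 2 := pow_le_pow_left₀ hm.le (min_le_right _ _) 2
    nlinarith [sq_nonneg t]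
  calc ‖(c : ℂ) + t * Complex.I‖ ^ (-r)
      ≤ (min 1 c * Real.sqrt (1 + ‖t‖ ^ 2)) ^ (-r) :=
        Real.rpow_le_rpow_of_nonpos (by positivity) h1 (by linarith)
    _ = _ := by
        rw [Real.mul_rpow hm.le (Real.sqrt_nonneg _), Real.sqrt_eq_rpow,
          ← Real.rpow_mul (by positivity)]
        congr 2
        ring

theorem integrable_one_add_sq_rpow {r : ℝ} (hr : 1 < r) :
    Integrable fun t : ℝ => (1 + ‖t‖ ^ 2) ^ (-r / 2) :=
  integrable_rpow_neg_one_add_norm_sq (by simpa using hr)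

theorem add_mul_I_ne_zero {c : ℝ} (hc : 0 < c) (t : ℝ) : (c : ℂ) + t * Complex.I ≠ 0 := by
  intro h
  have := congrArg Complex.re h
  simp at this
  exact hc.ne' this

theorem integral_Ioi_id_mul_exp_neg_mul {s : ℂ} (hs : 0 < s.re) :
    ∫ y in Set.Ioi (0 : ℝ), (y : ℂ) * Complex.exp (-(s * y)) = 1 / s ^ 2 := by
  have hs0 : s ≠ 0 := by
    rintro rfl
    simp at hs
  have hnorm (y : ℝ) : ‖Complex.exp (-(s * y))‖ = Real.exp (-s.re * y) := by
    rw [Complex.norm_exp]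
    simp
  have hint : IntegrableOn (fun y : ℝ => (y : ℂ) * Complex.exp (-(s * y))) (Set.Ioi 0) := by
    have h1 := integrableOn_rpow_mul_exp_neg_mul_rpow (s := 1) (p := 1) (b := s.re)
      (by norm_num) one_pos hs
    refine h1.mono' (Continuous.aestronglyMeasurable (by fun_prop)) ?_
    filter_upwards [ae_restrict_mem measurableSet_Ioi] with y hy
    rw [norm_mul, hnorm, Complex.norm_real, Real.norm_of_nonneg (le_of_lt hy), Real.rpow_one]
  have hderiv (y : ℝ) : HasDerivAt
      (fun y : ℝ => -((y : ℂ) / s + 1 / s ^ 2) * Complex.exp (-(s * y)))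
      ((y : ℂ) * Complex.exp (-(s * y))) y := by
    have h1 : HasDerivAt (fun y : ℝ => (y : ℂ)) 1 y := Complex.ofRealCLM.hasDerivAt
    refine ((((h1.div_const s).add_const (1 / s ^ 2)).fun_neg).mul
      ((h1.const_mul s).fun_neg.cexp)).congr_deriv ?_
    field_simp
    ring
  have hlim : Tendsto (fun y : ℝ => -((y : ℂ) / s + 1 / s ^ 2) * Complex.exp (-(s * y)))
      atTop (𝓝 0) := by
    have h1 : Tendsto (fun y : ℝ => (y : ℂ) * Complex.exp (-(s * y))) atTop (𝓝 0) := by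
      rw [tendsto_zero_iff_norm_tendsto_zero]
      refine (tendsto_rpow_mul_exp_neg_mul_atTop_nhds_zero 1 s.re hs).congr' ?_
      filter_upwards [eventually_ge_atTop 0] with y hy
      rw [norm_mul, hnorm, Complex.norm_real, Real.norm_of_nonneg hy, Real.rpow_one]
    have h2 : Tendsto (fun y : ℝ => Complex.exp (-(s * y))) atTop (𝓝 0) := by
      rw [tendsto_zero_iff_norm_tendsto_zero]
      refine (tendsto_rpow_mul_exp_neg_mul_atTop_nhds_zero 0 s.re hs).congr fun y => ?_
      rw [hnorm, Real.rpow_zero, one_mul]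
    have h3 := (h1.const_mul (-(1 / s))).add (h2.const_mul (-(1 / s ^ 2)))
    rw [mul_zero, mul_zero, add_zero] at h3
    refine h3.congr fun y => ?_
    ring
  rw [integral_Ioi_of_hasDerivAt_of_tendsto' (fun y _ => hderiv y) hint hlim]
  simp

theorem tendsto_verticalIntegral_one_div_sq {c x : ℝ} (hc : 0 < c) (hx : 0 < x) :
    Tendsto (fun T : ℝ => verticalIntegral c T (fun s => 1 / s ^ 2 * Complex.exp (x * s)))
      atTop (𝓝 (x : ℂ)) := by
  have hlap {s : ℂ} (hs : 0 < s.re) :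
      ∫ y : ℝ, (Set.Ioi (0 : ℝ)).indicator (fun y : ℝ => (y : ℂ)) y * Complex.exp (-(s * y)) =
        1 / s ^ 2 := by
    rw [← integral_Ioi_id_mul_exp_neg_mul hs, ← integral_indicator measurableSet_Ioi]
    refine integral_congr_ae (ae_of_all _ fun y => ?_)
    simp only [Set.indicator_apply]
    split_ifs <;> simp
  have hint : Integrable fun y : ℝ => (Set.Ioi (0 : ℝ)).indicator (fun y : ℝ => (y : ℂ)) y *
      Complex.exp (-((c : ℂ) * y)) := by
    -- A non-integrable function would have integral `0` by convention, whereas the integral is `1 /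
    -- c ^ 2`.
    by_contra h
    have h2 := integral_undef h
    rw [hlap (by simpa using hc)] at h2
    have : (c : ℂ) ≠ 0 := by exact_mod_cast hc.ne'
    simp [this] at h2
  have h3 := (tendsto_verticalIntegral_laplace (c := c) (x := x) hint
    ((integrable_one_add_sq_rpow (r := 2) one_lt_two).const_mul ((min 1 c) ^ (-2 : ℝ)))
    (fun t => by
      rw [hlap (by simpa using hc)]
      refine le_trans (le_of_eq ?_) (one_add_sq_rpow_bound hc zero_le_two t)
      rw [norm_div, norm_one, norm_pow, Real.rpow_neg (norm_nonneg _), one_div]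
      norm_cast)
    (by
      have : (fun y : ℝ => (y : ℂ)) =ᶠ[𝓝 x]
          (Set.Ioi (0 : ℝ)).indicator (fun y : ℝ => (y : ℂ)) := by
        filter_upwards [Ioi_mem_nhds hx] with y hy
        rw [Set.indicator_of_mem hy]
      exact ContinuousAt.congr (by fun_prop) this)).2
  rw [Set.indicator_of_mem (Set.mem_Ioi.2 hx)] at h3
  refine h3.congr fun T => ?_
  simp only [verticalIntegral]
  congr 1
  refine intervalIntegral.integral_congr fun t _ => ?_
  rw [hlap (by simpa using hc)]

/-- Since `1 / s` is not absolutely integrable, integration by parts reduces it to `1 / s ^ 2`: the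
boundary values of `e^{xs} / s` vanish in the limit, leaving `x / x = 1`. -/
theorem tendsto_verticalIntegral_one_div {c x : ℝ} (hc : 0 < c) (hx : 0 < x) :
    Tendsto (fun T : ℝ => verticalIntegral c T (fun s => 1 / s * Complex.exp (x * s)))
      atTop (𝓝 1) := by
  set B : ℝ → ℂ := fun t =>
    Complex.exp (x * ((c : ℂ) + t * Complex.I)) / ((c : ℂ) + t * Complex.I) with hB
  have hne := add_mul_I_ne_zero hc
  have hnorm (t : ℝ) : ‖B t‖ = Real.exp (x * c) * ‖(c : ℂ) + t * Complex.I‖⁻¹ := by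
    rw [hB]
    simp only
    rw [norm_div, Complex.norm_exp, div_eq_mul_inv]
    simp
  have hlow (t : ℝ) : |t| ≤ ‖(c : ℂ) + t * Complex.I‖ := by
    simpa using Complex.abs_im_le_norm ((c : ℂ) + t * Complex.I)
  have hsmall {u : ℝ → ℝ} (hu : Tendsto (fun T => |u T|) atTop atTop) :
      Tendsto (fun T => B (u T)) atTop (𝓝 0) := by
    rw [tendsto_zero_iff_norm_tendsto_zero]
    simp_rw [hnorm]
    have := (tendsto_inv_atTop_zero.comp
      (tendsto_atTop_mono (fun T => hlow (u T)) hu)).const_mul (Real.exp (x * c))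
    simpa using this
  have hbd : Tendsto (fun T : ℝ => 1 / (2 * Real.pi * Complex.I) * (B T - B (-T)))
      atTop (𝓝 0) := by
    have h1 : Tendsto (fun T : ℝ => B T) atTop (𝓝 0) := hsmall tendsto_abs_atTop_atTop
    have h2 : Tendsto (fun T : ℝ => B (-T)) atTop (𝓝 0) :=
      hsmall (by simpa using tendsto_abs_atTop_atTop)
    simpa using (h1.sub h2).const_mul (1 / (2 * Real.pi * Complex.I))
  have hparts (T : ℝ) : verticalIntegral c T (fun s => 1 / s * Complex.exp (x * s)) =
      (x : ℂ)⁻¹ * (1 / (2 * Real.pi * Complex.I) * (B T - B (-T)) +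
        verticalIntegral c T (fun s => 1 / s ^ 2 * Complex.exp (x * s))) := by
    have hs (t : ℝ) : HasDerivAt (fun t : ℝ => (c : ℂ) + t * Complex.I) Complex.I t := by
      simpa using ((Complex.ofRealCLM.hasDerivAt (x := t)).mul_const Complex.I).const_add (c : ℂ)
    have hcont1 : Continuous fun t : ℝ => 1 / ((c : ℂ) + t * Complex.I) *
        Complex.exp (x * ((c : ℂ) + t * Complex.I)) * Complex.I := by
      refine Continuous.mul (Continuous.mul (Continuous.div (by fun_prop) (by fun_prop) hne)
        (by fun_prop)) (by fun_prop)
    have hcont2 : Continuous fun t : ℝ => 1 / ((c : ℂ) + t * Complex.I) ^ 2 *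
        Complex.exp (x * ((c : ℂ) + t * Complex.I)) * Complex.I := by
      refine Continuous.mul (Continuous.mul (Continuous.div (by fun_prop) (by fun_prop)
        fun t => pow_ne_zero 2 (hne t)) (by fun_prop)) (by fun_prop)
    have hd (t : ℝ) : HasDerivAt B
        (x * (1 / ((c : ℂ) + t * Complex.I) *
          Complex.exp (x * ((c : ℂ) + t * Complex.I)) * Complex.I) -
        1 / ((c : ℂ) + t * Complex.I) ^ 2 *
          Complex.exp (x * ((c : ℂ) + t * Complex.I)) * Complex.I) t := by
      refine (((hs t).const_mul (x : ℂ)).cexp.div (hs t) (hne t)).congr_deriv ?_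
      have := hne t
      field_simp
    have hftc := intervalIntegral.integral_eq_sub_of_hasDerivAt (a := -T) (b := T)
      (fun t _ => hd t) ((Continuous.sub (hcont1.const_mul _) hcont2).intervalIntegrable _ _)
    rw [intervalIntegral.integral_sub ((hcont1.const_mul _).intervalIntegrable _ _)
      (hcont2.intervalIntegrable _ _), intervalIntegral.integral_const_mul] at hftc
    simp only [verticalIntegral]
    rw [← hftc]
    have : (x : ℂ) ≠ 0 := by exact_mod_cast hx.ne'
    rw [← mul_add, sub_add_cancel, mul_left_comm, inv_mul_cancel_left₀ this]
  simp_rw [hparts]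
  have := (hbd.add (tendsto_verticalIntegral_one_div_sq hc hx)).const_mul (x : ℂ)⁻¹
  rw [zero_add, inv_mul_cancel₀ (by exact_mod_cast hx.ne')] at this
  exact this

theorem norm_exp_sub_one_le_mul_exp (z : ℂ) : ‖Complex.exp z - 1‖ ≤ ‖z‖ * Real.exp ‖z‖ := by
  simpa using Complex.norm_exp_sub_sum_le_norm_mul_exp z 1

/-! ### Convolution powers of a kernel on the half-line -/

/-- A nonnegative density on `(0, ∞)` whose product with `e^{-cy}` is integrable. -/
structure IsHalfLineKernel (ρ : ℝ → ℝ) (c : ℝ) : Prop where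
  nonneg : ∀ y, 0 ≤ ρ y
  eq_zero : ∀ y ≤ 0, ρ y = 0
  integrable : Integrable fun y => ρ y * Real.exp (-(c * y))

/-- `convIter ρ m x` is the mass that the `m`-fold convolution power of `ρ(y) dy` gives to
`[0, x]`. -/
noncomputable def convIter (ρ : ℝ → ℝ) : ℕ → ℝ → ℝ
  | 0 => fun x => if 0 ≤ x then 1 else 0
  | m + 1 => fun x => ∫ y, ρ y * convIter ρ m (x - y)

/-- The mass that the convolution exponential of `ρ(y) dy` gives to `[0, x]`. -/
noncomputable def convExp (ρ : ℝ → ℝ) (x : ℝ) : ℝ := ∑' m : ℕ, convIter ρ m x / m.factorial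

namespace IsHalfLineKernel

variable {ρ : ℝ → ℝ} {c : ℝ}

theorem damped_nonneg (h : IsHalfLineKernel ρ c) : 0 ≤ ∫ y, ρ y * Real.exp (-(c * y)) :=
  integral_nonneg fun y => mul_nonneg (h.nonneg y) (Real.exp_pos _).le

theorem aestronglyMeasurable (h : IsHalfLineKernel ρ c) : AEStronglyMeasurable ρ := by
  have h1 := h.integrable.aestronglyMeasurable.mul
    (g := fun y => Real.exp (c * y)) (Continuous.aestronglyMeasurable (by fun_prop))
  refine h1.congr (ae_of_all _ fun y => ?_)
  simp only [Pi.mul_apply]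
  rw [mul_assoc, ← Real.exp_add, neg_add_cancel, Real.exp_zero, mul_one]

theorem integrable_mul_comp_sub (h : IsHalfLineKernel ρ c) {f : ℝ → ℝ} (hf : Measurable f)
    {M : ℝ} (hM : ∀ z, |f z| ≤ M * Real.exp (c * z)) (x : ℝ) :
    Integrable fun y => ρ y * f (x - y) := by
  refine Integrable.mono' (h.integrable.mul_const (M * Real.exp (c * x)))
    (h.aestronglyMeasurable.mul (hf.comp (by fun_prop)).aestronglyMeasurable)
    (ae_of_all _ fun y => ?_)
  rw [Real.norm_eq_abs, abs_mul, abs_of_nonneg (h.nonneg y), mul_assoc]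
  refine mul_le_mul_of_nonneg_left ((hM _).trans (le_of_eq ?_)) (h.nonneg y)
  rw [mul_left_comm, ← Real.exp_add]
  congr 2
  ring

/-- One induction carries all four facts, as integrability at the next stage needs monotonicity for
measurability and the exponential bound for domination. The bound starts from `1_{x ≥ 0} ≤ e^{cx}`,
and each convolution contributes one factor of the damped mass. -/
theorem convIter_props (h : IsHalfLineKernel ρ c) (hc : 0 < c) (m : ℕ) :
    Monotone (convIter ρ m) ∧ (∀ x, 0 ≤ convIter ρ m x) ∧ (∀ x < 0, convIter ρ m x = 0) ∧
      ∀ x, convIter ρ m x ≤ (∫ y, ρ y * Real.exp (-(c * y))) ^ m * Real.exp (c * x) := by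
  induction m with
  | zero =>
    refine ⟨?_, ?_, ?_, ?_⟩
    · intro x y hxy
      simp only [convIter]
      split_ifs with h1 h2
      · exact le_rfl
      · exact absurd (h1.trans hxy) h2
      · exact zero_le_one
      · exact le_rfl
    · intro x
      simp only [convIter]
      split_ifs <;> norm_num
    · intro x hx
      simp only [convIter]
      rw [if_neg (not_le.2 hx)]
    · intro x
      simp only [convIter, pow_zero, one_mul]
      split_ifs with h1
      · exact Real.one_le_exp (by positivity)
      · positivity
  | succ m ih =>
    obtain ⟨hmono, hnn, hz, hle⟩ := ih
    have hint := h.integrable_mul_comp_sub hmono.measurable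
      (fun z => (abs_of_nonneg (hnn z)).le.trans (hle z))
    refine ⟨?_, ?_, ?_, ?_⟩
    · intro x y hxy
      exact integral_mono (hint x) (hint y) fun z =>
        mul_le_mul_of_nonneg_left (hmono (by linarith)) (h.nonneg z)
    · intro x
      exact integral_nonneg fun y => mul_nonneg (h.nonneg y) (hnn _)
    · intro x hx
      refine integral_eq_zero_of_ae (ae_of_all _ fun y => ?_)
      simp only [Pi.zero_apply]
      rcases le_or_gt y 0 with hy | hy
      · rw [h.eq_zero y hy, zero_mul]
      · rw [hz _ (by linarith), mul_zero]
    · intro x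
      set K := ∫ y, ρ y * Real.exp (-(c * y)) with hK
      have h1 : convIter ρ (m + 1) x ≤
          ∫ y, (ρ y * Real.exp (-(c * y))) * (K ^ m * Real.exp (c * x)) := by
        refine integral_mono (hint x) (h.integrable.mul_const _) fun y => ?_
        simp only
        rw [mul_assoc]
        refine mul_le_mul_of_nonneg_left ((hle _).trans (le_of_eq ?_)) (h.nonneg y)
        rw [mul_left_comm, ← Real.exp_add]
        congr 2
        ring
      rw [integral_mul_const, ← hK] at h1
      refine h1.trans (le_of_eq ?_)
      ring

theorem convIter_monotone (h : IsHalfLineKernel ρ c) (hc : 0 < c) (m : ℕ) :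
    Monotone (convIter ρ m) := (h.convIter_props hc m).1

theorem convIter_nonneg (h : IsHalfLineKernel ρ c) (hc : 0 < c) (m : ℕ) (x : ℝ) :
    0 ≤ convIter ρ m x := (h.convIter_props hc m).2.1 x

theorem convIter_eq_zero (h : IsHalfLineKernel ρ c) (hc : 0 < c) (m : ℕ) {x : ℝ} (hx : x < 0) :
    convIter ρ m x = 0 := (h.convIter_props hc m).2.2.1 x hx

theorem convIter_le (h : IsHalfLineKernel ρ c) (hc : 0 < c) (m : ℕ) (x : ℝ) :
    convIter ρ m x ≤ (∫ y, ρ y * Real.exp (-(c * y))) ^ m * Real.exp (c * x) :=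
  (h.convIter_props hc m).2.2.2 x

theorem integrable_mul_convIter (h : IsHalfLineKernel ρ c) (hc : 0 < c) (m : ℕ) (x : ℝ) :
    Integrable fun y => ρ y * convIter ρ m (x - y) :=
  h.integrable_mul_comp_sub (h.convIter_monotone hc m).measurable
    (fun z => (abs_of_nonneg (h.convIter_nonneg hc m z)).le.trans (h.convIter_le hc m z)) x

theorem continuousAt_convIter (h : IsHalfLineKernel ρ c) (hc : 0 < c) (m : ℕ) {x : ℝ}
    (hx : x ≠ 0) : ContinuousAt (convIter ρ m) x := by
  induction m generalizing x with
  | zero =>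
    rcases lt_or_gt_of_ne hx with hx | hx
    · refine ContinuousAt.congr (f := fun _ => (0 : ℝ)) continuousAt_const ?_
      filter_upwards [Iio_mem_nhds hx] with y hy
      simp only [convIter]
      rw [if_neg (not_le.2 hy)]
    · refine ContinuousAt.congr (f := fun _ => (1 : ℝ)) continuousAt_const ?_
      filter_upwards [Ioi_mem_nhds hx] with y hy
      simp only [convIter]
      rw [if_pos (le_of_lt hy)]
  | succ m ih =>
    refine continuousAt_of_dominated (F := fun x y => ρ y * convIter ρ m (x - y))
      (bound := fun y => ρ y * Real.exp (-(c * y)) *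
        ((∫ y, ρ y * Real.exp (-(c * y))) ^ m * Real.exp (c * (x + 1))))
      (Eventually.of_forall fun z => (h.integrable_mul_convIter hc m z).aestronglyMeasurable)
      ?_ (h.integrable.mul_const _) ?_
    · filter_upwards [Iio_mem_nhds (show x < x + 1 by linarith)] with z hz
      refine ae_of_all _ fun y => ?_
      rw [Real.norm_of_nonneg (mul_nonneg (h.nonneg y) (h.convIter_nonneg hc m _)), mul_assoc]
      refine mul_le_mul_of_nonneg_left ((h.convIter_le hc m _).trans ?_) (h.nonneg y)
      rw [mul_left_comm, ← Real.exp_add]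
      refine mul_le_mul_of_nonneg_left (Real.exp_le_exp.2 ?_) (pow_nonneg h.damped_nonneg m)
      have := mul_le_mul_of_nonneg_left (le_of_lt hz) hc.le
      linarith
    -- The integrand can be discontinuous only at `y = x`, a null set.
    · filter_upwards [compl_mem_ae_iff.2 (measure_singleton x)] with y hy
      have hxy : x - y ≠ 0 := fun h0 => hy (by rw [Set.mem_singleton_iff]; linarith)
      exact continuousAt_const.mul
        (ContinuousAt.comp (f := fun x => x - y) (g := convIter ρ m) (ih hxy) (by fun_prop))

/-! ### Laplace transforms of the convolution powers -/

theorem integrable_mul_cexp (h : IsHalfLineKernel ρ c) {s : ℂ} (hs : s.re = c) :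
    Integrable fun y : ℝ => (ρ y : ℂ) * Complex.exp (-(s * y)) := by
  refine Integrable.mono' h.integrable ?_ (ae_of_all _ fun y => ?_)
  · exact (Complex.continuous_ofReal.comp_aestronglyMeasurable h.aestronglyMeasurable).mul
      (Continuous.aestronglyMeasurable (by fun_prop))
  · rw [norm_mul, Complex.norm_real, Real.norm_of_nonneg (h.nonneg y), Complex.norm_exp]
    simp [hs]

/-- Multiplication by `e^{-sx}` commutes with convolution, so each stage multiplies the transform by
that of `ρ`, starting from `1 / s` for the unit step. -/
theorem laplace_convIter (h : IsHalfLineKernel ρ c) (hc : 0 < c) {s : ℂ} (hs : s.re = c)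
    (m : ℕ) :
    Integrable (fun x : ℝ => (convIter ρ m x : ℂ) * Complex.exp (-(s * x))) ∧
    ∫ x : ℝ, (convIter ρ m x : ℂ) * Complex.exp (-(s * x)) =
      (∫ y : ℝ, (ρ y : ℂ) * Complex.exp (-(s * y))) ^ m / s := by
  induction m with
  | zero =>
    have h1 : (fun x : ℝ => (convIter ρ 0 x : ℂ) * Complex.exp (-(s * x))) =
        (Set.Ici (0 : ℝ)).indicator fun x : ℝ => Complex.exp (-s * x) := by
      ext x
      simp only [convIter, Set.indicator_apply, Set.mem_Ici]
      split_ifs <;> simp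
    have hre : (-s).re < 0 := by simp [hs, hc]
    rw [h1, integrable_indicator_iff measurableSet_Ici, integral_indicator measurableSet_Ici,
      integrableOn_Ici_iff_integrableOn_Ioi, integral_Ici_eq_integral_Ioi,
      integral_exp_mul_complex_Ioi hre]
    refine ⟨integrableOn_exp_mul_complex_Ioi hre 0, ?_⟩
    simp [neg_div]
  | succ m ih =>
    have hconv : (fun x : ℝ => (convIter ρ (m + 1) x : ℂ) * Complex.exp (-(s * x))) =
        convolution (fun y : ℝ => (ρ y : ℂ) * Complex.exp (-(s * y)))
          (fun x : ℝ => (convIter ρ m x : ℂ) * Complex.exp (-(s * x)))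
          (ContinuousLinearMap.mul ℂ ℂ) volume := by
      ext x
      simp only [convolution_def, ContinuousLinearMap.mul_apply', convIter]
      rw [← integral_complex_ofReal, ← integral_mul_const]
      refine integral_congr_ae (ae_of_all _ fun y => ?_)
      simp only
      rw [mul_mul_mul_comm, ← Complex.exp_add]
      push_cast
      congr 2
      ring
    rw [hconv]
    refine ⟨(h.integrable_mul_cexp hs).integrable_convolution _ ih.1, ?_⟩
    rw [integral_convolution _ (h.integrable_mul_cexp hs) ih.1, ih.2,
      ContinuousLinearMap.mul_apply', pow_succ', mul_div_assoc]

theorem integral_norm_convIter (h : IsHalfLineKernel ρ c) (hc : 0 < c) {s : ℂ} (hs : s.re = c)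
    (m : ℕ) :
    ∫ x : ℝ, ‖(convIter ρ m x : ℂ) * Complex.exp (-(s * x))‖ =
      (∫ y, ρ y * Real.exp (-(c * y))) ^ m / c := by
  have h1 := (h.laplace_convIter hc (s := c) (by simp) m).2
  have h2 (f : ℝ → ℝ) : ∫ x : ℝ, (f x : ℂ) * Complex.exp (-((c : ℂ) * x)) =
      ((∫ x : ℝ, f x * Real.exp (-(c * x)) : ℝ) : ℂ) := by
    rw [← integral_complex_ofReal]
    push_cast
    rfl
  rw [h2, h2] at h1
  have h3 : ∫ x : ℝ, convIter ρ m x * Real.exp (-(c * x)) =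
      (∫ y, ρ y * Real.exp (-(c * y))) ^ m / c := by exact_mod_cast h1
  rw [← h3]
  refine integral_congr_ae (ae_of_all _ fun x => ?_)
  simp only
  rw [norm_mul, Complex.norm_real, Real.norm_of_nonneg (h.convIter_nonneg hc m x),
    Complex.norm_exp]
  simp [hs]

theorem hasSum_convExp (h : IsHalfLineKernel ρ c) (hc : 0 < c) (x : ℝ) :
    HasSum (fun m : ℕ => convIter ρ m x / m.factorial) (convExp ρ x) := by
  refine Summable.hasSum ?_
  refine Summable.of_nonneg_of_le
    (fun m => div_nonneg (h.convIter_nonneg hc m x) (Nat.cast_nonneg _)) (fun m => ?_)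
    ((Real.summable_pow_div_factorial (∫ y, ρ y * Real.exp (-(c * y)))).mul_right
      (Real.exp (c * x)))
  rw [div_mul_eq_mul_div]
  gcongr
  exact h.convIter_le hc m x

theorem convExp_monotone (h : IsHalfLineKernel ρ c) (hc : 0 < c) : Monotone (convExp ρ) :=
  fun x y hxy => hasSum_le
    (fun m => div_le_div_of_nonneg_right (h.convIter_monotone hc m hxy) (Nat.cast_nonneg _))
    (h.hasSum_convExp hc x) (h.hasSum_convExp hc y)

theorem hasSum_convExp_sub (h : IsHalfLineKernel ρ c) (hc : 0 < c) (x : ℝ) :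
    HasSum (fun m : ℕ => convIter ρ (m + 1) x / (m + 1).factorial)
      (convExp ρ x - convIter ρ 0 x) := by
  have := (hasSum_nat_add_iff' 1).2 (h.hasSum_convExp hc x)
  simpa using this

theorem continuousAt_convExp_sub (h : IsHalfLineKernel ρ c) (hc : 0 < c) {x : ℝ} (hx : x ≠ 0) :
    ContinuousAt (fun x => convExp ρ x - convIter ρ 0 x) x := by
  have h1 : (fun x => convExp ρ x - convIter ρ 0 x) =
      fun x => ∑' m : ℕ, convIter ρ (m + 1) x / (m + 1).factorial := by
    ext x
    exact (h.hasSum_convExp_sub hc x).tsum_eq.symm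
  rw [h1]
  set K := ∫ y, ρ y * Real.exp (-(c * y)) with hK
  refine tendsto_tsum_of_dominated_convergence
    (bound := fun m : ℕ => K ^ (m + 1) / (m + 1).factorial * Real.exp (c * (x + 1))) ?_ ?_ ?_
  · exact ((summable_nat_add_iff 1).2 (Real.summable_pow_div_factorial K)).mul_right _
  · intro m
    exact (h.continuousAt_convIter hc (m + 1) hx).div_const _
  · filter_upwards [Iio_mem_nhds (show x < x + 1 by linarith)] with z hz m
    rw [Real.norm_of_nonneg (div_nonneg (h.convIter_nonneg hc _ _) (Nat.cast_nonneg _)),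
      div_mul_eq_mul_div]
    refine div_le_div_of_nonneg_right ((h.convIter_le hc _ _).trans ?_) (Nat.cast_nonneg _)
    refine mul_le_mul_of_nonneg_left (Real.exp_le_exp.2 ?_) (pow_nonneg h.damped_nonneg _)
    exact mul_le_mul_of_nonneg_left (le_of_lt hz) hc.le

/-- The unit step `convIter ρ 0` is removed because it carries the jump at `0` and the slowly
decaying `1 / s`. The remaining series is transformed termwise, its `L¹` norms being dominated by an
exponential series. -/
theorem laplace_convExp_sub (h : IsHalfLineKernel ρ c) (hc : 0 < c) {s : ℂ} (hs : s.re = c) :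
    Integrable (fun x : ℝ => ((convExp ρ x - convIter ρ 0 x : ℝ) : ℂ) * Complex.exp (-(s * x))) ∧
    ∫ x : ℝ, ((convExp ρ x - convIter ρ 0 x : ℝ) : ℂ) * Complex.exp (-(s * x)) =
      1 / s * (Complex.exp (∫ y : ℝ, (ρ y : ℂ) * Complex.exp (-(s * y))) - 1) := by
  set l := ∫ y : ℝ, (ρ y : ℂ) * Complex.exp (-(s * y)) with hl
  set K := ∫ y, ρ y * Real.exp (-(c * y)) with hK
  set F : ℕ → ℝ → ℂ := fun m x => ((m + 1).factorial : ℂ)⁻¹ *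
    ((convIter ρ (m + 1) x : ℂ) * Complex.exp (-(s * x))) with hF
  have hFint (m : ℕ) : Integrable (F m) := (h.laplace_convIter hc hs (m + 1)).1.const_mul _
  have hFnorm (m : ℕ) : ∫ x, ‖F m x‖ = K ^ (m + 1) / (m + 1).factorial * (1 / c) := by
    simp only [hF, norm_mul _ ((_ : ℂ) * _)]
    rw [integral_const_mul, h.integral_norm_convIter hc hs, norm_inv, Complex.norm_natCast]
    ring
  have hsum : Summable fun m => ∫ x, ‖F m x‖ := by
    simp_rw [hFnorm]
    exact ((summable_nat_add_iff 1).2 (Real.summable_pow_div_factorial K)).mul_right _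
  have htsum (x : ℝ) : HasSum (fun m => F m x)
      (((convExp ρ x - convIter ρ 0 x : ℝ) : ℂ) * Complex.exp (-(s * x))) := by
    have h1 := (Complex.hasSum_ofReal.2 (h.hasSum_convExp_sub hc x)).mul_right
      (Complex.exp (-(s * x)))
    have h2 : (fun m => F m x) = fun m : ℕ =>
        ((convIter ρ (m + 1) x / (m + 1).factorial : ℝ) : ℂ) * Complex.exp (-(s * x)) := by
      funext m
      simp only [hF]
      push_cast
      ring
    rw [h2]
    exact h1
  have heq : (fun x : ℝ => ((convExp ρ x - convIter ρ 0 x : ℝ) : ℂ) * Complex.exp (-(s * x))) =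
      fun x => ∑' m, F m x := funext fun x => (htsum x).tsum_eq.symm
  rw [heq]
  constructor
  · refine ⟨?_, ?_⟩
    · rw [← heq]
      have h1 : Measurable fun x => convExp ρ x - convIter ρ 0 x :=
        (h.convExp_monotone hc).measurable.sub (h.convIter_monotone hc 0).measurable
      exact (Complex.measurable_ofReal.comp h1).aestronglyMeasurable.mul
        (Continuous.aestronglyMeasurable (by fun_prop))
    · calc ∫⁻ x, ‖∑' m, F m x‖ₑ ≤ ∫⁻ x, ∑' m, ‖F m x‖ₑ :=
            lintegral_mono fun x => enorm_tsum_le_tsum_enorm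
        _ = ∑' m, ∫⁻ x, ‖F m x‖ₑ :=
            lintegral_tsum fun m => (hFint m).aestronglyMeasurable.enorm
        _ = ∑' m, ENNReal.ofReal (∫ x, ‖F m x‖) :=
            tsum_congr fun m => (ofReal_integral_norm_eq_lintegral_enorm (hFint m)).symm
        _ < ⊤ := hsum.tsum_ofReal_lt_top
  · have h2 := hasSum_integral_of_summable_integral_norm hFint hsum
    refine h2.unique ?_
    have h3 := NormedSpace.expSeries_div_hasSum_exp l
    rw [← Complex.exp_eq_exp_ℂ, ← hasSum_nat_add_iff' 1] at h3
    simp only [Finset.sum_range_one, pow_zero, Nat.factorial_zero, Nat.cast_one, div_one] at h3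
    have h4 : (fun m => ∫ x, F m x) = fun m : ℕ => 1 / s * (l ^ (m + 1) / (m + 1).factorial) := by
      funext m
      simp only [hF]
      rw [integral_const_mul, (h.laplace_convIter hc hs (m + 1)).2]
      ring
    rw [h4]
    exact h3.mul_left (1 / s)

theorem tendsto_verticalIntegral_convExp (h : IsHalfLineKernel ρ c) (hc : 0 < c) {α D : ℝ}
    (hα : 0 < α) (hD : 0 ≤ D)
    (hdecay : ∀ s : ℂ, s.re = c →
      ‖∫ y : ℝ, (ρ y : ℂ) * Complex.exp (-(s * y))‖ ≤ D * ‖s‖ ^ (-α)) {x : ℝ} (hx : 0 < x) :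
    Tendsto (fun T : ℝ => verticalIntegral c T (fun s =>
      1 / s * Complex.exp (∫ y : ℝ, (ρ y : ℂ) * Complex.exp (-(s * y))) * Complex.exp (x * s)))
      atTop (𝓝 (convExp ρ x : ℂ)) := by
  have hre (t : ℝ) : ((c : ℂ) + t * Complex.I).re = c := by simp
  -- From `|e^z - 1| ≤ |z| e^{|z|}` with `|z| ≤ D |s|^{-α}`, where `|s| ≥ c` bounds the exponent.
  set E := D * Real.exp (D * c ^ (-α)) with hE
  obtain ⟨h1, h2⟩ := tendsto_verticalIntegral_laplace (c := c) (x := x)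
    (F := fun x => ((convExp ρ x - convIter ρ 0 x : ℝ) : ℂ))
    (h.laplace_convExp_sub hc (s := c) (by simp)).1
    ((integrable_one_add_sq_rpow (r := 1 + α) (by linarith)).const_mul
      (E * (min 1 c) ^ (-(1 + α))))
    (fun t => by
      rw [(h.laplace_convExp_sub hc (hre t)).2]
      set s := (c : ℂ) + t * Complex.I with hs
      have hcs : c ≤ ‖s‖ := (hre t).symm.le.trans (Complex.re_le_norm s)
      have hs0 : 0 < ‖s‖ := hc.trans_le hcs
      have hl := hdecay s (hre t)
      have hl2 : D * ‖s‖ ^ (-α) ≤ D * c ^ (-α) :=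
        mul_le_mul_of_nonneg_left (Real.rpow_le_rpow_of_nonpos hc hcs (by linarith)) hD
      rw [norm_mul, norm_div, norm_one, one_div, mul_assoc]
      calc ‖s‖⁻¹ * ‖Complex.exp (∫ y : ℝ, (ρ y : ℂ) * Complex.exp (-(s * y))) - 1‖
          ≤ ‖s‖⁻¹ * (D * ‖s‖ ^ (-α) * Real.exp (D * c ^ (-α))) := by
            refine mul_le_mul_of_nonneg_left ?_ (by positivity)
            refine (norm_exp_sub_one_le_mul_exp _).trans ?_
            exact mul_le_mul hl (Real.exp_le_exp.2 (hl.trans hl2)) (Real.exp_pos _).le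
              (by positivity)
        _ = E * ‖s‖ ^ (-(1 + α)) := by
            rw [neg_add, Real.rpow_add hs0, Real.rpow_neg_one]
            ring
        _ ≤ _ := mul_le_mul_of_nonneg_left (one_add_sq_rpow_bound hc (by linarith) t)
            (by positivity))
    (Complex.continuous_ofReal.continuousAt.comp (h.continuousAt_convExp_sub hc hx.ne'))
  have h3 := (tendsto_verticalIntegral_one_div hc hx).add h2
  have h4 : (1 : ℂ) + ((convExp ρ x - convIter ρ 0 x : ℝ) : ℂ) = convExp ρ x := by
    simp [convIter, hx.le]
  rw [h4] at h3
  refine h3.congr fun T => ?_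
  have hcont1 : Continuous fun t : ℝ => 1 / ((c : ℂ) + t * Complex.I) *
      Complex.exp (x * ((c : ℂ) + t * Complex.I)) * Complex.I := by
    refine Continuous.mul (Continuous.mul (Continuous.div (by fun_prop) (by fun_prop)
      (add_mul_I_ne_zero hc)) (by fun_prop)) (by fun_prop)
  simp only [verticalIntegral]
  rw [← mul_add, ← intervalIntegral.integral_add (hcont1.intervalIntegrable _ _)
    (h1.mul_const Complex.I).intervalIntegrable]
  congr 1
  refine intervalIntegral.integral_congr fun t _ => ?_
  rw [(h.laplace_convExp_sub hc (hre t)).2]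
  ring

end IsHalfLineKernel

/-! ### The kernel of the truncated logarithm -/

/-- The density of the push-forward of `γ(x) dx / k` under `x ↦ kx`. -/
noncomputable def dilatedKernel (γ : ℝ → ℝ) (k : ℕ) : ℝ → ℝ :=
  (Set.Ioi (0 : ℝ)).indicator fun y => γ (y / k) / (k : ℝ) ^ 2

/-- The density whose Laplace transform is `lambdaSum γ N`. -/
noncomputable def lambdaKernel (γ : ℝ → ℝ) (N : ℕ) (y : ℝ) : ℝ :=
  ∑ k ∈ Finset.Icc 1 N, dilatedKernel γ k y

/-- Bounded variation serves for measurability: it splits `γ` into a difference of monotone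
functions on `(0, ∞)`. -/
theorem ClassF.aemeasurable_comp_div {γ : ℝ → ℝ} (hγ : γ ∈ ClassF) {k : ℝ} (hk : 0 < k) :
    AEMeasurable (fun y => γ (y / k)) (volume.restrict (Set.Ioi 0)) := by
  have hloc : LocallyBoundedVariationOn γ (Set.Ioi 0) := by
    intro a b _ hb
    refine BoundedVariationOn.mono (hγ.1 0 (b + 1) le_rfl ?_) ?_
    · have : (0 : ℝ) < b := hb
      linarith
    · rintro z ⟨hz, hzab⟩
      exact ⟨hz, by linarith [hzab.2]⟩
  obtain ⟨p, q, hp, hq, rfl⟩ := hloc.exists_monotoneOn_sub_monotoneOn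
  have hdil {r : ℝ → ℝ} (hr : MonotoneOn r (Set.Ioi 0)) :
      AEMeasurable (fun y => r (y / k)) (volume.restrict (Set.Ioi 0)) := by
    refine aemeasurable_restrict_of_monotoneOn measurableSet_Ioi fun x hx y hy hxy => ?_
    exact hr (div_pos hx hk) (div_pos hy hk) (by gcongr)
  exact (hdil hp).sub (hdil hq)

theorem isHalfLineKernel_dilatedKernel {γ : ℝ → ℝ} (hγ : γ ∈ ClassF)
    (h0 : ∀ x : ℝ, 0 ≤ x → 0 ≤ γ x) {c : ℝ} (hc : 0 < c) {k : ℕ} (hk : 1 ≤ k) :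
    IsHalfLineKernel (dilatedKernel γ k) c where
  nonneg y := Set.indicator_nonneg
    (fun y hy => div_nonneg (h0 _ (div_nonneg (le_of_lt hy) (Nat.cast_nonneg k))) (sq_nonneg _)) y
  eq_zero y hy := Set.indicator_of_notMem (by simpa using hy) _
  integrable := by
    have hk1 : (1 : ℝ) ≤ k := by exact_mod_cast hk
    -- Growth at rate `c / 2` leaves the integrable majorant `C e^{-cy/2}`.
    obtain ⟨C, hC, hle⟩ := hγ.2 (c / 2) (by positivity)
    have h1 : (fun y => dilatedKernel γ k y * Real.exp (-(c * y))) =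
        (Set.Ioi (0 : ℝ)).indicator fun y => γ (y / k) / (k : ℝ) ^ 2 * Real.exp (-(c * y)) := by
      ext y
      simp only [dilatedKernel, Set.indicator_apply]
      split_ifs <;> simp
    rw [h1, integrable_indicator_iff measurableSet_Ioi]
    have h2 := (exp_neg_integrableOn_Ioi 0 (show 0 < c / 2 by positivity)).const_mul C
    refine Integrable.mono' h2 ?_ ?_
    · exact ((ClassF.aemeasurable_comp_div hγ (by positivity)).div_const
        _).aestronglyMeasurable.mul (Continuous.aestronglyMeasurable (by fun_prop))
    · filter_upwards [ae_restrict_mem measurableSet_Ioi] with y hy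
      have hy0 : (0 : ℝ) < y := hy
      rw [norm_mul, Real.norm_eq_abs, Real.norm_of_nonneg (Real.exp_pos _).le, abs_div,
        abs_of_nonneg (sq_nonneg (k : ℝ))]
      have h3 : |γ (y / k)| / (k : ℝ) ^ 2 ≤ C * Real.exp (c / 2 * y) := by
        refine (div_le_self (abs_nonneg _) (one_le_pow₀ hk1)).trans ?_
        refine (hle _ (by positivity)).trans ?_
        gcongr
        exact div_le_self hy0.le hk1
      calc |γ (y / k)| / (k : ℝ) ^ 2 * Real.exp (-(c * y))
          ≤ C * Real.exp (c / 2 * y) * Real.exp (-(c * y)) := by gcongr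
        _ = C * Real.exp (-(c / 2) * y) := by
            rw [mul_assoc, ← Real.exp_add]
            congr 2
            ring

theorem isHalfLineKernel_lambdaKernel {γ : ℝ → ℝ} (hγ : γ ∈ ClassF)
    (h0 : ∀ x : ℝ, 0 ≤ x → 0 ≤ γ x) {c : ℝ} (hc : 0 < c) (N : ℕ) :
    IsHalfLineKernel (lambdaKernel γ N) c where
  nonneg y := Finset.sum_nonneg fun k hk =>
    (isHalfLineKernel_dilatedKernel hγ h0 hc (Finset.mem_Icc.1 hk).1).nonneg y
  eq_zero y hy := Finset.sum_eq_zero fun k hk =>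
    (isHalfLineKernel_dilatedKernel hγ h0 hc (Finset.mem_Icc.1 hk).1).eq_zero y hy
  integrable := by
    simp only [lambdaKernel, Finset.sum_mul]
    exact integrable_finsetSum _ fun k hk =>
      (isHalfLineKernel_dilatedKernel hγ h0 hc (Finset.mem_Icc.1 hk).1).integrable

section Dilation

variable {E : Type*} [NormedAddCommGroup E] [NormedSpace ℝ E]

theorem dilatedKernel_smul_eq (γ : ℝ → ℝ) (k : ℕ) (f : ℝ → E) :
    (fun y => dilatedKernel γ k y • f y) =
      (Set.Ioi (0 : ℝ)).indicator fun y => (γ (y / k) / (k : ℝ) ^ 2) • f y := by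
  ext y
  simp only [dilatedKernel, Set.indicator_apply]
  split_ifs <;> simp

/-- The substitution `y = ku` uses up one of the two factors `1 / k`. Values in `E` cover both the
complex transform and the real convolution. -/
theorem integral_dilatedKernel_smul (γ : ℝ → ℝ) {k : ℕ} (hk : 1 ≤ k) (f : ℝ → E) :
    ∫ y, dilatedKernel γ k y • f y =
      (k : ℝ)⁻¹ • ∫ u in Set.Ioi (0 : ℝ), γ u • f (k * u) := by
  have hk0 : (0 : ℝ) < k := by exact_mod_cast hk
  rw [dilatedKernel_smul_eq, integral_indicator measurableSet_Ioi]
  have h1 := integral_comp_mul_left_Ioi' (fun y => (γ (y / k) / (k : ℝ) ^ 2) • f y) 0 hk0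
  rw [mul_zero] at h1
  rw [← h1, ← integral_smul, ← integral_smul]
  refine integral_congr_ae (ae_of_all _ fun u => ?_)
  simp only
  rw [mul_div_cancel_left₀ _ hk0.ne', smul_smul, smul_smul]
  congr 1
  field_simp

theorem integrableOn_of_integrable_dilatedKernel_smul {γ : ℝ → ℝ} {k : ℕ} (hk : 1 ≤ k)
    {f : ℝ → E} (hf : Integrable fun y => dilatedKernel γ k y • f y) :
    IntegrableOn (fun u => γ u • f (k * u)) (Set.Ioi (0 : ℝ)) := by
  have hk0 : (0 : ℝ) < k := by exact_mod_cast hk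
  rw [dilatedKernel_smul_eq, integrable_indicator_iff measurableSet_Ioi] at hf
  have h1 := (integrableOn_Ioi_comp_mul_left_iff
    (fun y => (γ (y / k) / (k : ℝ) ^ 2) • f y) 0 hk0).2 (by rwa [mul_zero])
  refine (h1.smul ((k : ℝ) ^ 2)).congr (ae_of_all _ fun u => ?_)
  simp only [Pi.smul_apply]
  rw [mul_div_cancel_left₀ _ hk0.ne', smul_smul]
  congr 1
  field_simp

end Dilation

section Kernel

variable {γ : ℝ → ℝ} {c : ℝ}

theorem laplace_lambdaKernel (hγ : γ ∈ ClassF) (h0 : ∀ x : ℝ, 0 ≤ x → 0 ≤ γ x) (hc : 0 < c)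
    (N : ℕ) {s : ℂ} (hs : s.re = c) :
    ∫ y : ℝ, (lambdaKernel γ N y : ℂ) * Complex.exp (-(s * y)) = lambdaSum γ N s := by
  simp only [lambdaKernel, lambdaSum, Complex.ofReal_sum, Finset.sum_mul]
  rw [integral_finsetSum _ fun k hk =>
    (isHalfLineKernel_dilatedKernel hγ h0 hc (Finset.mem_Icc.1 hk).1).integrable_mul_cexp hs]
  refine Finset.sum_congr rfl fun k hk => ?_
  have h1 := integral_dilatedKernel_smul γ (Finset.mem_Icc.1 hk).1
    (fun y : ℝ => Complex.exp (-(s * y)))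
  simp only [Complex.real_smul] at h1
  rw [h1, laplaceW, div_eq_inv_mul]
  push_cast
  congr 1
  refine integral_congr_ae (ae_of_all _ fun u => ?_)
  simp only [mul_assoc]

theorem integrableOn_mul_convIter (hγ : γ ∈ ClassF) (h0 : ∀ x : ℝ, 0 ≤ x → 0 ≤ γ x) (hc : 0 < c)
    (N m : ℕ) {k : ℕ} (hk : 1 ≤ k) (x : ℝ) :
    IntegrableOn (fun u => γ u * convIter (lambdaKernel γ N) m (x - k * u))
      (Set.Ioi (0 : ℝ)) := by
  have h := isHalfLineKernel_lambdaKernel hγ h0 hc N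
  exact integrableOn_of_integrable_dilatedKernel_smul hk
    (f := fun y => convIter (lambdaKernel γ N) m (x - y))
    ((isHalfLineKernel_dilatedKernel hγ h0 hc hk).integrable_mul_comp_sub
      (h.convIter_monotone hc m).measurable
      (fun z => (abs_of_nonneg (h.convIter_nonneg hc m z)).le.trans (h.convIter_le hc m z)) x)

/-- The continuous counterpart of `coeff_logSeries_mul`: the two recursions match term by term in
`k`. -/
theorem convIter_lambdaKernel_succ (hγ : γ ∈ ClassF) (h0 : ∀ x : ℝ, 0 ≤ x → 0 ≤ γ x)
    (hc : 0 < c) (N m : ℕ) (x : ℝ) :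
    convIter (lambdaKernel γ N) (m + 1) x = ∑ k ∈ Finset.Icc 1 N, (k : ℝ)⁻¹ *
      ∫ u in Set.Ioi (0 : ℝ), γ u * convIter (lambdaKernel γ N) m (x - k * u) := by
  have h := isHalfLineKernel_lambdaKernel hγ h0 hc N
  have h1 : convIter (lambdaKernel γ N) (m + 1) x =
      ∫ y, ∑ k ∈ Finset.Icc 1 N, dilatedKernel γ k y * convIter (lambdaKernel γ N) m (x - y) := by
    simp only [convIter, lambdaKernel, Finset.sum_mul]
  rw [h1, integral_finsetSum _ fun k hk =>
    (isHalfLineKernel_dilatedKernel hγ h0 hc (Finset.mem_Icc.1 hk).1).integrable_mul_comp_sub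
      (h.convIter_monotone hc m).measurable
      (fun z => (abs_of_nonneg (h.convIter_nonneg hc m z)).le.trans (h.convIter_le hc m z)) x]
  refine Finset.sum_congr rfl fun k hk => ?_
  exact integral_dilatedKernel_smul γ (Finset.mem_Icc.1 hk).1
    (fun y : ℝ => convIter (lambdaKernel γ N) m (x - y))

theorem bromwichConvergesTo_convExp (hγ : γ ∈ ClassF) (h0 : ∀ x : ℝ, 0 ≤ x → 0 ≤ γ x)
    (hc : 0 < c) {N : ℕ} (hdecay : TransformDecay γ N c) {x : ℝ} (hx : 0 < x) :
    BromwichConvergesTo γ N c x (convExp (lambdaKernel γ N) x) := by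
  obtain ⟨α, D, hα, hD, hw⟩ := hdecay
  have h := isHalfLineKernel_lambdaKernel hγ h0 hc N
  -- The constant `N * D` sums `N` terms, each at most `D |s|^{-α}` because `k ≥ 1`.
  have h1 := h.tendsto_verticalIntegral_convExp hc hα (D := N * D) (by positivity) (fun s hs => by
    have hs0 : 0 < ‖s‖ := hc.trans_le (hs.symm.le.trans (Complex.re_le_norm s))
    rw [laplace_lambdaKernel hγ h0 hc N hs, lambdaSum]
    have h2 : ∀ k ∈ Finset.Icc 1 N, ‖laplaceW γ k s / k‖ ≤ D * ‖s‖ ^ (-α) := by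
      intro k hk
      obtain ⟨hk1, hkN⟩ := Finset.mem_Icc.1 hk
      have hk' : (1 : ℝ) ≤ k := by exact_mod_cast hk1
      rw [norm_div, Complex.norm_natCast]
      refine (div_le_self (norm_nonneg _) hk').trans ((hw k hk1 hkN s hs).trans ?_)
      refine mul_le_mul_of_nonneg_left (Real.rpow_le_rpow_of_nonpos hs0 ?_ (by linarith)) hD.le
      rw [norm_mul, Complex.norm_natCast]
      exact le_mul_of_one_le_left hs0.le hk'
    refine (norm_sum_le_of_le _ h2).trans (le_of_eq ?_)
    rw [Finset.sum_const, Nat.card_Icc, Nat.add_sub_cancel, nsmul_eq_mul, mul_assoc]) hx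
  refine h1.congr fun T => ?_
  simp only [verticalIntegral]
  congr 1
  refine intervalIntegral.integral_congr fun t _ => ?_
  rw [laplace_lambdaKernel hγ h0 hc N (by simp)]

end Kernel

/-! ### Comparison with the discrete convolution powers -/

theorem sum_range_le_integral_Ioi {f : ℝ → ℝ} (hf : IntegrableOn f (Set.Ioi 0))
    (hnn : ∀ u : ℝ, 0 < u → 0 ≤ f u) (a : ℕ → ℝ) (M : ℕ)
    (ha : ∀ n < M, ∀ u ∈ Set.Ioo (n : ℝ) (n + 1), a n ≤ f u) :
    ∑ n ∈ Finset.range M, a n ≤ ∫ u in Set.Ioi (0 : ℝ), f u := by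
  have hsub (p q : ℝ) (hp : 0 ≤ p) : IntegrableOn f (Set.Ioc p q) :=
    hf.mono_set fun u hu => hp.trans_lt hu.1
  have hii (n : ℕ) : IntervalIntegrable f volume (n : ℝ) ((n + 1 : ℕ) : ℝ) :=
    (intervalIntegrable_iff_integrableOn_Ioc_of_le (by push_cast; linarith)).2
      (hsub _ _ (Nat.cast_nonneg n))
  calc ∑ n ∈ Finset.range M, a n
      ≤ ∑ n ∈ Finset.range M, ∫ u in (n : ℝ)..((n + 1 : ℕ) : ℝ), f u := by
        refine Finset.sum_le_sum fun n hn => ?_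
        have h1 := intervalIntegral.integral_mono_on_of_le_Ioo (a := (n : ℝ))
          (b := ((n + 1 : ℕ) : ℝ)) (f := fun _ => a n) (g := f) (by push_cast; linarith)
          intervalIntegrable_const (hii n)
          (fun u hu => ha n (Finset.mem_range.1 hn) u (by push_cast at hu; exact hu))
        simpa using h1
    _ = ∫ u in (0 : ℝ)..M, f u := by
        have := intervalIntegral.sum_integral_adjacent_intervals (f := f) (μ := volume)
          (a := fun n : ℕ => (n : ℝ)) (n := M) fun n _ => hii n
        simpa using this
    _ ≤ ∫ u in Set.Ioi (0 : ℝ), f u := by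
        rw [intervalIntegral.integral_of_le (Nat.cast_nonneg M)]
        refine setIntegral_mono_set hf ?_ ?_
        · filter_upwards [ae_restrict_mem measurableSet_Ioi] with u hu
          exact hnn u hu
        · exact (show Set.Ioc (0 : ℝ) M ⊆ Set.Ioi 0 from fun u hu => hu.1).eventuallyLE

theorem integral_Ioi_le_sum_range {f : ℝ → ℝ} (hf : IntegrableOn f (Set.Ioi 0)) (a : ℕ → ℝ)
    (M : ℕ) (hzero : ∀ u : ℝ, (M : ℝ) < u → f u = 0)
    (ha : ∀ n < M, ∀ u ∈ Set.Ioo (n : ℝ) (n + 1), f u ≤ a n) :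
    ∫ u in Set.Ioi (0 : ℝ), f u ≤ ∑ n ∈ Finset.range M, a n := by
  have hii (n : ℕ) : IntervalIntegrable f volume (n : ℝ) ((n + 1 : ℕ) : ℝ) :=
    (intervalIntegrable_iff_integrableOn_Ioc_of_le (by push_cast; linarith)).2
      (hf.mono_set fun u hu => (Nat.cast_nonneg n).trans_lt hu.1)
  calc ∫ u in Set.Ioi (0 : ℝ), f u = ∫ u in (0 : ℝ)..M, f u := by
        rw [intervalIntegral.integral_of_le (Nat.cast_nonneg M)]
        refine setIntegral_eq_of_subset_of_forall_sdiff_eq_zero measurableSet_Ioi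
          (fun u hu => hu.1) fun u hu => hzero u ?_
        by_contra hle
        exact hu.2 ⟨hu.1, not_lt.1 hle⟩
    _ = ∑ n ∈ Finset.range M, ∫ u in (n : ℝ)..((n + 1 : ℕ) : ℝ), f u := by
        have := intervalIntegral.sum_integral_adjacent_intervals (f := f) (μ := volume)
          (a := fun n : ℕ => (n : ℝ)) (n := M) fun n _ => hii n
        simpa using this.symm
    _ ≤ ∑ n ∈ Finset.range M, a n := by
        refine Finset.sum_le_sum fun n hn => ?_
        have h1 := intervalIntegral.integral_mono_on_of_le_Ioo (a := (n : ℝ))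
          (b := ((n + 1 : ℕ) : ℝ)) (f := f) (g := fun _ => a n) (by push_cast; linarith)
          (hii n) intervalIntegrable_const
          (fun u hu => ha n (Finset.mem_range.1 hn) u (by push_cast at hu; exact hu))
        simpa using h1

theorem coeff_logSeries_mul (g : ℝ → ℝ) (N : ℕ) (I : Finset ℕ) (A : PowerSeries ℝ) (j : ℕ) :
    PowerSeries.coeff j (logSeries g N I * A) = ∑ k ∈ Finset.Icc 1 N, (k : ℝ)⁻¹ *
      ∑ n ∈ I, g n * if k * n ≤ j then PowerSeries.coeff (j - k * n) A else 0 := by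
  simp only [logSeries, Finset.sum_mul, map_sum, Finset.mul_sum]
  refine Finset.sum_congr rfl fun k _ => Finset.sum_congr rfl fun n _ => ?_
  rw [mul_assoc, PowerSeries.coeff_C_mul, PowerSeries.coeff_X_pow_mul']
  ring

theorem coeff_logSeries_pow_mul_nonneg {g : ℝ → ℝ} {I : Finset ℕ} (hg : ∀ n ∈ I, 0 ≤ g n)
    (N m j : ℕ) :
    0 ≤ PowerSeries.coeff j (logSeries g N I ^ m * PowerSeries.mk 1) := by
  induction m generalizing j with
  | zero => simp
  | succ m ih =>
    rw [pow_succ', mul_assoc, coeff_logSeries_mul]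
    refine Finset.sum_nonneg fun k _ => mul_nonneg (by positivity) ?_
    refine Finset.sum_nonneg fun n hn => mul_nonneg (hg n hn) ?_
    split_ifs
    · exact ih _
    · exact le_rfl

/-- `PowerSeries.mk 1` is `1 / (1 - X)`, so the left side is the discrete mass of `[0, j]`. On the
cell `n < u < n + 1` one has `⌈u⌉ = n + 1` and `j - k (n + 1) ≤ j - k u`, so both the weight and, by
monotonicity, the remaining mass are larger on the continuous side. -/
theorem coeff_logSeries_pow_le_convIter {g γ : ℝ → ℝ} {c : ℝ} (hγ : γ ∈ ClassF)
    (h0 : ∀ x : ℝ, 0 ≤ x → 0 ≤ γ x) (hc : 0 < c) (hg : ∀ n : ℕ, 0 < n → 0 ≤ g n)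
    (hle : ∀ x : ℝ, 0 ≤ x → g (⌈x⌉ : ℝ) ≤ γ x) (N m j : ℕ) :
    PowerSeries.coeff j (logSeries g N (Finset.Icc 1 N) ^ m * PowerSeries.mk 1) ≤
      convIter (lambdaKernel γ N) m j := by
  have h := isHalfLineKernel_lambdaKernel hγ h0 hc N
  induction m generalizing j with
  | zero => simp [convIter]
  | succ m ih =>
    rw [pow_succ', mul_assoc, coeff_logSeries_mul, convIter_lambdaKernel_succ hγ h0 hc]
    refine Finset.sum_le_sum fun k hk => mul_le_mul_of_nonneg_left ?_ (by positivity)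
    rw [sum_Icc_one_eq_sum_range]
    refine sum_range_le_integral_Ioi
      (integrableOn_mul_convIter hγ h0 hc N m (Finset.mem_Icc.1 hk).1 j)
      (fun u hu => mul_nonneg (h0 u hu.le) (h.convIter_nonneg hc m _)) _ N fun n _ u hu => ?_
    have hu0 : 0 ≤ u := (Nat.cast_nonneg n).trans hu.1.le
    have hceil : ⌈u⌉ = ((n + 1 : ℕ) : ℤ) := by
      rw [Int.ceil_eq_iff]
      push_cast
      exact ⟨by linarith [hu.1], hu.2.le⟩
    have h1 : g ((n + 1 : ℕ) : ℝ) ≤ γ u := by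
      have := hle u hu0
      rwa [hceil, Int.cast_natCast] at this
    refine mul_le_mul h1 ?_ ?_ (h0 u hu0)
    · split_ifs with hkn
      · refine (ih _).trans (h.convIter_monotone hc m ?_)
        rw [Nat.cast_sub hkn]
        push_cast
        have := mul_le_mul_of_nonneg_left hu.2.le (Nat.cast_nonneg (α := ℝ) k)
        linarith
      · exact h.convIter_nonneg hc m _
    · split_ifs
      · refine coeff_logSeries_pow_mul_nonneg ?_ _ _ _
        intro i hi
        exact hg i (Finset.mem_Icc.1 hi).1
      · exact le_rfl

/-- Now `⌊u⌋ = n` and `j - k u ≤ j - k n` on each cell, reversing the comparison; the cell at `0`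
brings in `g 0`. -/
theorem convIter_le_coeff_logSeries_pow {g γ : ℝ → ℝ} {c : ℝ} (hγ : γ ∈ ClassF)
    (h0 : ∀ x : ℝ, 0 ≤ x → 0 ≤ γ x) (hc : 0 < c) (hg : ∀ n : ℕ, 0 ≤ g n)
    (hle : ∀ x : ℝ, 0 ≤ x → γ x ≤ g (⌊x⌋ : ℝ)) (N m : ℕ) {j : ℕ} (hj : j ≤ N) :
    convIter (lambdaKernel γ N) m j ≤
      PowerSeries.coeff j (logSeries g N (Finset.range (N + 1)) ^ m * PowerSeries.mk 1) := by
  have h := isHalfLineKernel_lambdaKernel hγ h0 hc N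
  induction m generalizing j with
  | zero => simp [convIter]
  | succ m ih =>
    rw [pow_succ', mul_assoc, coeff_logSeries_mul, convIter_lambdaKernel_succ hγ h0 hc]
    refine Finset.sum_le_sum fun k hk => mul_le_mul_of_nonneg_left ?_ (by positivity)
    have hk1 : (1 : ℝ) ≤ k := by exact_mod_cast (Finset.mem_Icc.1 hk).1
    -- The `N + 1` cells suffice: for `u > N + 1` the argument `j - k u` is negative because `j ≤
    -- N`.
    refine integral_Ioi_le_sum_range
      (integrableOn_mul_convIter hγ h0 hc N m (Finset.mem_Icc.1 hk).1 j) _ (N + 1)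
      (fun u hu => ?_) fun n _ u hu => ?_
    · have hjN : (j : ℝ) ≤ N := by exact_mod_cast hj
      push_cast at hu
      have hu0 : 0 ≤ u := by linarith [Nat.cast_nonneg (α := ℝ) N]
      have := le_mul_of_one_le_left hu0 hk1
      rw [h.convIter_eq_zero hc m (by linarith), mul_zero]
    · have hu0 : 0 ≤ u := (Nat.cast_nonneg n).trans hu.1.le
      have hfloor : ⌊u⌋ = ((n : ℕ) : ℤ) := by
        rw [Int.floor_eq_iff]
        push_cast
        exact ⟨hu.1.le, hu.2⟩
      have h1 : γ u ≤ g n := by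
        have := hle u hu0
        rwa [hfloor, Int.cast_natCast] at this
      have hmul := mul_le_mul_of_nonneg_left hu.1.le (Nat.cast_nonneg (α := ℝ) k)
      refine mul_le_mul h1 ?_ (h.convIter_nonneg hc m _) (hg n)
      split_ifs with hkn
      · refine le_trans (h.convIter_monotone hc m ?_) (ih (j := j - k * n) (by omega))
        rw [Nat.cast_sub hkn]
        push_cast
        linarith
      · refine (h.convIter_eq_zero hc m ?_).le
        have : (j : ℝ) < k * n := by exact_mod_cast not_le.1 hkn
        linarith

/-- Multiplying by `1 / (1 - X)` turns the coefficient at `N` into the partial sum up to `N`. -/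
theorem hasSum_sum_genPartition {g : ℝ → ℝ} {N : ℕ}
    (hg : ∀ n : ℕ, 0 < n → ∃ m : ℕ, 0 < m ∧ g (n : ℝ) = (m : ℝ)) {I : Finset ℕ}
    (hI : I.erase 0 = Finset.Icc 1 N) :
    HasSum (fun m : ℕ =>
        PowerSeries.coeff N (logSeries g N I ^ m * PowerSeries.mk (1 : ℕ → ℝ)) / m.factorial)
      (Real.exp (PowerSeries.coeff 0 (logSeries g N I)) *
        ∑ n ∈ Finset.range (N + 1), genPartition g n) := by
  have h1 := hasSum_coeff_pow_mul (logSeries g N I) (PowerSeries.mk 1) N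
  convert h1 using 1
  rw [PowerSeries.coeff_mul, Finset.Nat.sum_antidiagonal_eq_sum_range_succ_mk, Finset.mul_sum]
  refine Finset.sum_congr rfl fun j hj => ?_
  rw [PowerSeries.coeff_mk, Pi.one_apply, mul_one,
    coeff_seriesExp_logSeries hg hI (Nat.lt_succ_iff.1 (Finset.mem_range.1 hj))]

theorem coeff_zero_logSeries (g : ℝ → ℝ) (N : ℕ) (I : Finset ℕ) :
    PowerSeries.coeff 0 (logSeries g N I) =
      if 0 ∈ I then g 0 * ∑ k ∈ Finset.Icc 1 N, (k : ℝ)⁻¹ else 0 := by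
  have h1 : ∀ k ∈ Finset.Icc 1 N,
      PowerSeries.coeff 0 (∑ n ∈ I, PowerSeries.C (g n / k) * PowerSeries.X ^ (k * n)) =
        if 0 ∈ I then g 0 * (k : ℝ)⁻¹ else 0 := by
    intro k hk
    have hk0 : k ≠ 0 := Nat.one_le_iff_ne_zero.1 (Finset.mem_Icc.1 hk).1
    rw [map_sum]
    have h2 : ∀ n ∈ I, PowerSeries.coeff 0
        (PowerSeries.C (g n / k) * PowerSeries.X ^ (k * n) : PowerSeries ℝ) =
          if n = 0 then g 0 * (k : ℝ)⁻¹ else 0 := by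
      intro n _
      rw [PowerSeries.coeff_C_mul, PowerSeries.coeff_X_pow]
      by_cases hn : n = 0
      · simp [hn, div_eq_mul_inv]
      · simp [hn, hk0, eq_comm]
    rw [Finset.sum_congr rfl h2, Finset.sum_ite_eq']
  rw [logSeries, map_sum, Finset.sum_congr rfl h1]
  split_ifs
  · rw [Finset.mul_sum]
  · simp

theorem mainTheorem4 (g : ℝ → ℝ)
    (hg : ∀ n : ℕ, 0 < n → ∃ m : ℕ, 0 < m ∧ g (n : ℝ) = (m : ℝ))
    (c : ℝ) (hc : 0 < c) (N : ℕ) (hN : 0 < N) :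
    (∀ gp : ℝ → ℝ, gp ∈ ClassF → (∀ x : ℝ, 0 ≤ x → 0 ≤ gp x) →
      (∀ x : ℝ, 0 ≤ x → g (⌈x⌉ : ℝ) ≤ gp x) →
      TransformDecay gp N c →
      ∃ φ : ℝ → ℝ, (∀ x : ℝ, 0 < x → BromwichConvergesTo gp N c x (φ x)) ∧
        ∑ n ∈ Finset.range (N + 1), genPartition g n ≤ φ N) ∧
    (∀ gm : ℝ → ℝ, gm ∈ ClassF → (∀ x : ℝ, 0 ≤ x → 0 ≤ gm x) →
      (∀ x : ℝ, 0 ≤ x → gm x ≤ g (⌊x⌋ : ℝ)) →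
      TransformDecay gm N c →
      ∃ φ : ℝ → ℝ, (∀ x : ℝ, 0 < x → BromwichConvergesTo gm N c x (φ x)) ∧
        Real.exp (-g 0) * (N : ℝ) ^ (-g 0) * φ N ≤
          ∑ n ∈ Finset.range (N + 1), genPartition g n) := by
  have hgpos : ∀ n : ℕ, 0 < n → 0 ≤ g n := by
    intro n hn
    obtain ⟨m, -, hm⟩ := hg n hn
    rw [hm]
    exact Nat.cast_nonneg m
  refine ⟨fun gp hF h0 hle hdecay => ⟨convExp (lambdaKernel gp N),
    fun x hx => bromwichConvergesTo_convExp hF h0 hc hdecay hx, ?_⟩,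
    fun gm hF h0 hle hdecay => ⟨convExp (lambdaKernel gm N),
    fun x hx => bromwichConvergesTo_convExp hF h0 hc hdecay hx, ?_⟩⟩
  · have h := isHalfLineKernel_lambdaKernel hF h0 hc N
    have h1 := hasSum_sum_genPartition hg (N := N) (I := Finset.Icc 1 N) (by simp)
    rw [coeff_zero_logSeries, if_neg (by simp), Real.exp_zero, one_mul] at h1
    exact hasSum_le (fun m => div_le_div_of_nonneg_right
      (coeff_logSeries_pow_le_convIter hF h0 hc hgpos hle N m N) (Nat.cast_nonneg _)) h1
      (h.hasSum_convExp hc N)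
  · have h := isHalfLineKernel_lambdaKernel hF h0 hc N
    -- The sign of `g 0` is not assumed; it follows from `0 ≤ gm 0 ≤ g 0`.
    have hg0 : 0 ≤ g 0 := by simpa using (h0 0 le_rfl).trans (hle 0 le_rfl)
    have hgnn : ∀ n : ℕ, 0 ≤ g n := by
      intro n
      rcases Nat.eq_zero_or_pos n with rfl | hn
      · simpa using hg0
      · exact hgpos n hn
    have h1 := hasSum_sum_genPartition hg (N := N) (I := Finset.range (N + 1))
      (by ext; simp; omega)
    rw [coeff_zero_logSeries, if_pos (by simp)] at h1
    have h2 : convExp (lambdaKernel gm N) N ≤ _ :=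
      hasSum_le (fun m => div_le_div_of_nonneg_right
        (convIter_le_coeff_logSeries_pow hF h0 hc hgnn hle N m le_rfl) (Nat.cast_nonneg _))
        (h.hasSum_convExp hc N) h1
    -- This harmonic bound is the source of the factor `e^{-g(0)} N^{-g(0)}`.
    have h3 : ∑ k ∈ Finset.Icc 1 N, (k : ℝ)⁻¹ ≤ 1 + Real.log N := by
      have := harmonic_le_one_add_log N
      rw [harmonic_eq_sum_Icc] at this
      push_cast at this
      exact this
    have h4 : 0 ≤ convExp (lambdaKernel gm N) N :=
      (h.hasSum_convExp hc N).nonneg fun m =>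
        div_nonneg (h.convIter_nonneg hc m _) (Nat.cast_nonneg _)
    have hNpos : (0 : ℝ) < N := by exact_mod_cast hN
    calc Real.exp (-g 0) * (N : ℝ) ^ (-g 0) * convExp (lambdaKernel gm N) N
        = Real.exp (-(g 0 * (1 + Real.log N))) * convExp (lambdaKernel gm N) N := by
          rw [Real.rpow_def_of_pos hNpos, ← Real.exp_add]
          congr 2
          ring
      _ ≤ Real.exp (-(g 0 * ∑ k ∈ Finset.Icc 1 N, (k : ℝ)⁻¹)) *
            convExp (lambdaKernel gm N) N := by
          refine mul_le_mul_of_nonneg_right (Real.exp_le_exp.2 (neg_le_neg ?_)) h4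
          exact mul_le_mul_of_nonneg_left h3 hg0
      _ ≤ Real.exp (-(g 0 * ∑ k ∈ Finset.Icc 1 N, (k : ℝ)⁻¹)) * _ :=
          mul_le_mul_of_nonneg_left h2 (Real.exp_pos _).le
      _ = ∑ n ∈ Finset.range (N + 1), genPartition g n := by
          rw [← mul_assoc, ← Real.exp_add, neg_add_cancel, Real.exp_zero, one_mul]
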